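/- **Theorem 1.8.** Let $(M^n,g)$, $n\ge 3$, be a compact connected Riemannian manifold (without boundary) with $\mathrm{Ric}=2\mu g$ for a constant $\mu>0$, let $\phi=c$ be a constant function, and let $\lambda=0$. *Notation.* For $(M,g,\phi)$ with $\lambda=0$, a normal weighted ambient space is a smooth family $(g_u,\phi_u)$, $u$ in an open interval $I\ni 0$, with $(g_0,\phi_0)=(g,\phi)$, such that for $\widetilde g=2\,du\,dv+g_u$ and $\widetilde\phi=\phi_u-v$ on $\mathbb R\times M\times I$ the tensor $\widetilde{\mathrm{Ric}}+\widetilde\nabla^2\widetilde\phi$ and the function $\widetilde\Delta\widetilde\phi-|\widetilde\nabla\widetilde\phi|^2$ are $O(u^\infty)$ at $u=0$; it is global if both vanish identically. Put $$v_{k,\phi}=\frac1{k!}\,\partial_u^k\Big|_{u=0}\,\frac{e^{-\phi_u}}{e^{-\phi}}\Big(\frac{\det g_u}{\det g}\Big)^{1/2},\qquad \mathcal F_{k,\phi}=\int_M v_{k,\phi}\,e^{-\phi}\,\mathrm{dvol}_g .$$ The gradient Ricci flow is $\partial_t g=-2(\mathrm{Ric}+\nabla^2\phi)$, $\partial_t\phi=-R-\Delta\phi$.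 *The flow.* There is a global normal weighted ambient space for $(M,g,c)$ with $I=(-\frac1{4\mu},\infty)$ that is real-analytic in $u$ and on which the integral curves below exist. For every normal weighted ambient space for $(M,g,c)$ that is real-analytic in $u$, on an open interval $I\ni0$, one has $1+4\mu u>0$ on $I$ and $$g_u=(1+4\mu u)\,g,\qquad \phi_u=\tfrac n4\ln|1+4\mu u|+c .$$ Along the integral curves of $X=v_{1,\phi}\,\partial_v-\partial_u$ that start at $u=v=0$ at time $t=0$, where $v_{1,\phi}=\frac12(R+2\Delta\phi-|\nabla\phi|^2)$ is computed from $(g_u,\phi_u)$, the pair $(g_u,\widetilde\phi)$ is a solution $(g_t,\phi_t)$, $-t\in I$, of the gradient Ricci flow with initial value $(g,c)$. Each $(M,g_t,\phi_t)$ has a normal weighted ambient space, and any such space (not necessarily analytic) gives $$v_{k,\phi_t}=\frac1{k!}\Big(\frac{\mu}{1-4\mu t}\Big)^k\prod_{i=0}^{k-1}(n-4i)\qquad(k\ge 0).$$ *Monotonicity.* Along this flow, for $k\ge1$, $\mathcal F_{k,\phi}$ is strictly increasing in $t$, strictly decreasing in $t$, or identically $0$ according to whether $\prod_{i=0}^{k-1}(n-4i)$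 is positive, negative, or zero. Consequently, for every integer $j\ge 1$: 1. if $4(j-1)<n<4j$, then $\mathcal F_{k,\phi}$ is strictly increasing for $k\in\{1,\dots,j\}\cup\{j+2s : s\ge1\}$ and strictly decreasing for $k\in\{j+2s-1 : s\ge 1\}$; 2. if $n=4j$, then $\mathcal F_{k,\phi}$ is strictly increasing for $k\in\{1,\dots,j\}$ and identically $0$ for $k>j$. -/

import Mathlib

open scoped Manifold ContDiff

noncomputable section

namespace WeightedAmbient

/-! ### Pseudo-Riemannian geometry of a metric given in linear coordinates

`V` is a (finite-dimensional) coordinate space, `G : V → Bil V` the coordinate expression of a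
(possibly indefinite) metric, and `f : V → ℝ` the coordinate expression of a function. -/

/-- Continuous bilinear forms on `V`. -/
abbrev Bil (V : Type*) [NormedAddCommGroup V] [NormedSpace ℝ V] := V →L[ℝ] V →L[ℝ] ℝ

section Local

variable {V : Type*} [NormedAddCommGroup V] [NormedSpace ℝ V]

/-- The Christoffel symbols `Γ(X, Y)` of the Levi-Civita connection, that is, half of the image
of the covector `Z ↦ (∂_X G)(Y, Z) + (∂_Y G)(X, Z) - (∂_Z G)(X, Y)` under the musical isomorphism
`V* → V` inverse to `G x`. -/
def christoffel (G : V → Bil V) (x : V) : V →L[ℝ] V →L[ℝ] V :=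
  let D : V →L[ℝ] V →L[ℝ] V →L[ℝ] ℝ := fderiv ℝ G x
  let flip : (V →L[ℝ] V →L[ℝ] ℝ) →L[ℝ] (V →L[ℝ] V →L[ℝ] ℝ) :=
    (ContinuousLinearMap.flipₗᵢ ℝ V V ℝ).toContinuousLinearEquiv
  let sharp : (V →L[ℝ] V →L[ℝ] ℝ) →L[ℝ] (V →L[ℝ] V) :=
    ContinuousLinearMap.compL ℝ V (V →L[ℝ] ℝ) V (G x).inverse
  (2⁻¹ : ℝ) • (sharp.comp D + sharp.comp D.flip - sharp.comp (flip.comp D.flip))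

/-- The value of the Christoffel symbols, as in the textbook formula. -/
theorem christoffel_apply (G : V → Bil V) (x X Y : V) (θ : V →L[ℝ] ℝ)
    (hθ : ∀ Z, θ Z = fderiv ℝ G x X Y Z + fderiv ℝ G x Y X Z - fderiv ℝ G x Z X Y) :
    christoffel G x X Y = (2⁻¹ : ℝ) • (G x).inverse θ := by
  have h : θ = fderiv ℝ G x X Y + fderiv ℝ G x Y X - ((fderiv ℝ G x).flip X).flip Y := by
    ext Z; simp [hθ]
  rw [h]
  simp only [map_sub, map_add]
  rfl

/-- The endomorphism `X ↦ R(X, Y) Z`, where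
`R(X, Y) Z = (∂_X Γ)(Y, Z) - (∂_Y Γ)(X, Z) + Γ(X, Γ(Y, Z)) - Γ(Y, Γ(X, Z))`
is the curvature `∇_X ∇_Y Z - ∇_Y ∇_X Z - ∇_[X,Y] Z`. -/
def curvatureEnd (G : V → Bil V) (x Y Z : V) : V →L[ℝ] V :=
  (((fderiv ℝ (christoffel G) x).flip Y).flip Z) - (fderiv ℝ (christoffel G) x Y).flip Z
    + (christoffel G x).flip (christoffel G x Y Z)
    - (christoffel G x Y).comp ((christoffel G x).flip Z)

/-- The Ricci tensor `Ric(Y, Z) = tr (X ↦ R(X, Y) Z)`. -/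
def ricci (G : V → Bil V) (x : V) : V →ₗ[ℝ] V →ₗ[ℝ] ℝ :=
  LinearMap.mk₂ ℝ (fun Y Z => LinearMap.trace ℝ V (curvatureEnd G x Y Z : V →ₗ[ℝ] V))
    (fun Y Y' Z => by
      rw [← map_add]; congr 1; ext X; simp [curvatureEnd]; abel)
    (fun a Y Z => by
      rw [← map_smul]; congr 1; ext X; simp [curvatureEnd, smul_sub, smul_add])
    (fun Y Z Z' => by
      rw [← map_add]; congr 1; ext X; simp [curvatureEnd]; abel)
    (fun a Y Z => by
      rw [← map_smul]; congr 1; ext X; simp [curvatureEnd, smul_sub, smul_add])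

/-- The Hessian `(∇²f)(X, Y) = ∂_X ∂_Y f - df(Γ(X, Y))`. -/
def hessian (G : V → Bil V) (f : V → ℝ) (x : V) : V →ₗ[ℝ] V →ₗ[ℝ] ℝ :=
  LinearMap.mk₂ ℝ (fun X Y => fderiv ℝ (fderiv ℝ f) x X Y - fderiv ℝ f x (christoffel G x X Y))
    (fun X X' Y => by simp; ring)
    (fun a X Y => by simp; ring)
    (fun X Y Y' => by simp; ring)
    (fun a X Y => by simp; ring)

variable [FiniteDimensional ℝ V]

/-- The trace `G^{ij} T_{ij}` of a bilinear form `T` with respect to a nondegenerate form `b`. -/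
def metricTrace (b : Bil V) (T : V →ₗ[ℝ] V →ₗ[ℝ] ℝ) : ℝ :=
  LinearMap.trace ℝ V
    ((b.inverse : (V →L[ℝ] ℝ) →ₗ[ℝ] V) ∘ₗ
      (LinearMap.toContinuousLinearMap : (V →ₗ[ℝ] ℝ) ≃ₗ[ℝ] (V →L[ℝ] ℝ)).toLinearMap ∘ₗ T)

/-- The scalar curvature `R`. -/
def scalarCurvature (G : V → Bil V) (x : V) : ℝ := metricTrace (G x) (ricci G x)

/-- The Laplacian `Δf = tr ∇²f`. -/
def laplacian (G : V → Bil V) (f : V → ℝ) (x : V) : ℝ := metricTrace (G x) (hessian G f x)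

/-- The square norm `|∇f|² = df(∇f)` of the gradient. -/
def gradSq (G : V → Bil V) (f : V → ℝ) (x : V) : ℝ :=
  fderiv ℝ f x ((G x).inverse (fderiv ℝ f x))

/-- The Bakry–Émery Ricci tensor `Ric_φ = Ric + ∇²φ`; for `λ = 0` this is also `P_φ`. -/
def weightedRicci (G : V → Bil V) (f : V → ℝ) (x : V) : V →ₗ[ℝ] V →ₗ[ℝ] ℝ :=
  ricci G x + hessian G f x

/-- The scalar `F_φ = Δφ - |∇φ|²` (the case `λ = 0`). -/
def weightedF (G : V → Bil V) (f : V → ℝ) (x : V) : ℝ := laplacian G f x - gradSq G f x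

/-- The weighted scalar curvature `R_φ = R + 2Δφ - |∇φ|²` (the case `λ = 0`). -/
def weightedScalar (G : V → Bil V) (f : V → ℝ) (x : V) : ℝ :=
  scalarCurvature G x + 2 * laplacian G f x - gradSq G f x

end Local

/-! ### Riemannian metrics on a manifold, in charts -/

/-- The coordinate space of an `n`-manifold. -/
abbrev Euc (n : ℕ) := EuclideanSpace ℝ (Fin n)

/-- Smooth Riemannian metrics on the `n`-manifold `M`. -/
abbrev Metric (n : ℕ) (M : Type*) [TopologicalSpace M] [ChartedSpace (Euc n) M]
    [IsManifold (𝓡 n) ∞ M] :=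
  Bundle.ContMDiffRiemannianMetric (𝓡 n) ∞ (Euc n) (fun x : M => TangentSpace (𝓡 n) x)

section Manifold

variable {n : ℕ} {M : Type*} [TopologicalSpace M] [ChartedSpace (Euc n) M]
  [IsManifold (𝓡 n) ∞ M]

/-- The coordinate expression of `g` in the chart at `p`: the pullback of `g` by the inverse of
that chart. It is meaningful on the (open) target of the chart. -/
def coordMetric (g : Metric n M) (p : M) (y : Euc n) : Bil (Euc n) :=
  let A : Euc n →L[ℝ] TangentSpace (𝓡 n) ((extChartAt (𝓡 n) p).symm y) :=
    mfderiv 𝓘(ℝ, Euc n) (𝓡 n) (extChartAt (𝓡 n) p).symm y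
  (A.precomp ℝ).comp ((g.inner ((extChartAt (𝓡 n) p).symm y)).comp A)

/-- The coordinate expression of a function on `M` in the chart at `p`. -/
def coordFun (f : M → ℝ) (p : M) (y : Euc n) : ℝ := f ((extChartAt (𝓡 n) p).symm y)

/-- The determinant `det (g_ij)` in the chart at `p`. -/
def gramDet (g : Metric n M) (p : M) (y : Euc n) : ℝ :=
  Matrix.det (Matrix.of fun i j : Fin n =>
    coordMetric g p y (EuclideanSpace.single i 1) (EuclideanSpace.single j 1))

/-- `Ric = κ g`, as an identity of tensor fields: it holds in every chart. -/
def IsEinstein (g : Metric n M) (κ : ℝ) : Prop :=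
  ∀ p : M, ∀ y ∈ (extChartAt (𝓡 n) p).target, ∀ X Y : Euc n,
    ricci (coordMetric g p) y X Y = κ * coordMetric g p y X Y

/-- `(g_s, φ_s)`, `s ∈ J`, is a family of metric measure structures that is jointly smooth
on `M × J` (in every chart). -/
def IsSmoothFamily (J : Set ℝ) (g : ℝ → Metric n M) (φ : ℝ → M → ℝ) : Prop :=
  ∀ p : M,
    ContDiffOn ℝ ∞ (fun z : Euc n × ℝ => coordMetric (g z.2) p z.1)
      ((extChartAt (𝓡 n) p).target ×ˢ J) ∧
    ContDiffOn ℝ ∞ (fun z : Euc n × ℝ => coordFun (φ z.2) p z.1)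
      ((extChartAt (𝓡 n) p).target ×ˢ J)

/-- The gradient Ricci flow
`∂_t g = -2 (Ric + ∇²φ)`, `∂_t φ = -R - Δφ` for times `t ∈ J`. -/
def IsGradientRicciFlow (J : Set ℝ) (g : ℝ → Metric n M) (φ : ℝ → M → ℝ) : Prop :=
  IsSmoothFamily J g φ ∧
  ∀ t ∈ J, ∀ p : M, ∀ y ∈ (extChartAt (𝓡 n) p).target,
    (∀ X Y : Euc n, HasDerivAt (fun s => coordMetric (g s) p y X Y)
      (-2 * weightedRicci (coordMetric (g t) p) (coordFun (φ t) p) y X Y) t) ∧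
    HasDerivAt (fun s => coordFun (φ s) p y)
      (-scalarCurvature (coordMetric (g t) p) y
        - laplacian (coordMetric (g t) p) (coordFun (φ t) p) y) t

/-- The function `v_{1,φ} = R_φ / 2` of `(M, g, φ, λ = 0)`, computed in the chart at `x`. -/
def vOne (g : Metric n M) (φ : M → ℝ) (x : M) : ℝ :=
  (1 / 2) * weightedScalar (coordMetric g x) (coordFun φ x) (extChartAt (𝓡 n) x x)

/-! ### The Riemannian volume measure -/

section Volume

variable [T2Space M] [SigmaCompactSpace M]

variable (n M) in
/-- A smooth partition of unity, indexed by the points of `M`, whose member of index `p` is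
supported in the domain of the chart at `p`. -/
def chartPartition : SmoothPartitionOfUnity M (𝓡 n) M Set.univ :=
  Classical.choose (SmoothPartitionOfUnity.exists_isSubordinate_chartAt_source (𝓡 n) M)

variable (n M) in
theorem chartPartition_subordinate :
    (chartPartition n M).IsSubordinate (fun x => (chartAt (Euc n) x).source) :=
  Classical.choose_spec (SmoothPartitionOfUnity.exists_isSubordinate_chartAt_source (𝓡 n) M)

/-- The Riemannian volume measure `dvol_g`: with a partition of unity `(ρ_p)` subordinate to the
charts, the sum over `p` of the measures `ρ_p √(det g_ij) dy` transported to `M` by the charts. -/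
def riemannianVolume [MeasurableSpace M] (g : Metric n M) : MeasureTheory.Measure M :=
  MeasureTheory.Measure.sum fun p : M =>
    (((MeasureTheory.volume : MeasureTheory.Measure (Euc n)).restrict
        (extChartAt (𝓡 n) p).target).withDensity fun y =>
          ENNReal.ofReal
            (chartPartition n M p ((extChartAt (𝓡 n) p).symm y) * √(gramDet g p y))).map
      (extChartAt (𝓡 n) p).symm

end Volume

/-! ### Normal weighted ambient spaces -/

/-- The coordinate space of the ambient space; its points are written `(v, y, u)`. -/
abbrev Amb (n : ℕ) := ℝ × Euc n × ℝ

/-- The metric `2 du dv + g_u` on `ℝ × M × ℝ`, in the coordinates `(v, y, u)` given by the chart of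
`M` at `p`. -/
def ambientMetric (g : ℝ → Metric n M) (p : M) (z : Amb n) : Bil (Amb n) :=
  let dv : Amb n →L[ℝ] ℝ := ContinuousLinearMap.fst ℝ ℝ (Euc n × ℝ)
  let dy : Amb n →L[ℝ] Euc n :=
    (ContinuousLinearMap.fst ℝ (Euc n) ℝ).comp (ContinuousLinearMap.snd ℝ ℝ (Euc n × ℝ))
  let du : Amb n →L[ℝ] ℝ :=
    (ContinuousLinearMap.snd ℝ (Euc n) ℝ).comp (ContinuousLinearMap.snd ℝ ℝ (Euc n × ℝ))
  dv.smulRight du + du.smulRight dv + (coordMetric (g z.2.2) p z.2.1).bilinearComp dy dy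

/-- The function `φ_u - v` on `ℝ × M × ℝ`, in the same coordinates. -/
def ambientPotential (φ : ℝ → M → ℝ) (p : M) (z : Amb n) : ℝ :=
  coordFun (φ z.2.2) p z.2.1 - z.1

/-- The function `r` of `u` vanishes to infinite order at `u = 0`. -/
def VanishesToInfiniteOrder (r : ℝ → ℝ) : Prop :=
  ∀ m : ℕ, r =O[nhds 0] fun u => u ^ m

/-- A normal weighted ambient space for the manifold with density `(M, g, φ, λ = 0)`: a smooth
family `(g_u, φ_u)`, with `u` in an open interval `dom` containing `0` and `(g_0, φ_0) = (g, φ)`,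
such that for the Lorentzian metric `2 du dv + g_u` and the function `φ_u - v` on `ℝ × M × dom`
the tensor `Ric + ∇²φ` and the function `Δφ - |∇φ|²` are `O(u^∞)` at `u = 0`.
(The values of `metric` and `potential` outside `dom` carry no meaning.) -/
structure NormalAmbientSpace (g : Metric n M) (φ : M → ℝ) where
  /-- the interval of the coordinate `u` -/
  dom : Set ℝ
  isOpen_dom : IsOpen dom
  ordConnected_dom : dom.OrdConnected
  zero_mem_dom : (0 : ℝ) ∈ dom
  /-- the metrics `g_u` -/
  metric : ℝ → Metric n M
  /-- the functions `φ_u` -/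
  potential : ℝ → M → ℝ
  metric_zero : metric 0 = g
  potential_zero : potential 0 = φ
  smooth : IsSmoothFamily dom metric potential
  ricci_vanishes : ∀ p : M, ∀ y ∈ (extChartAt (𝓡 n) p).target, ∀ (v : ℝ) (ξ η : Amb n),
    VanishesToInfiniteOrder fun u =>
      weightedRicci (ambientMetric metric p) (ambientPotential potential p) (v, y, u) ξ η
  F_vanishes : ∀ p : M, ∀ y ∈ (extChartAt (𝓡 n) p).target, ∀ v : ℝ,
    VanishesToInfiniteOrder fun u =>
      weightedF (ambientMetric metric p) (ambientPotential potential p) (v, y, u)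

namespace NormalAmbientSpace

variable {g : Metric n M} {φ : M → ℝ}

/-- The ambient space is global: the ambient equations hold exactly on all of `ℝ × M × dom`. -/
def IsGlobal (A : NormalAmbientSpace g φ) : Prop :=
  ∀ p : M, ∀ y ∈ (extChartAt (𝓡 n) p).target, ∀ v : ℝ, ∀ u ∈ A.dom,
    (∀ ξ η : Amb n,
      weightedRicci (ambientMetric A.metric p) (ambientPotential A.potential p) (v, y, u) ξ η
        = 0) ∧
    weightedF (ambientMetric A.metric p) (ambientPotential A.potential p) (v, y, u) = 0

/-- At each point of `M`, `g_u` and `φ_u` are real-analytic functions of `u`. -/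
def IsAnalytic (A : NormalAmbientSpace g φ) : Prop :=
  ∀ x : M,
    (∀ X Y : TangentSpace (𝓡 n) x,
      AnalyticOnNhd ℝ (fun u => (A.metric u).inner x X Y) A.dom) ∧
    AnalyticOnNhd ℝ (fun u => A.potential u x) A.dom

/-- The renormalized volume
`v_φ = (e^{-φ̃} / e^{-φ}) (det g_u / det g)^{1/2}` on `v = 0`, at the point `x` of `M`. -/
def renormalizedVolume (A : NormalAmbientSpace g φ) (x : M) (u : ℝ) : ℝ :=
  Real.exp (-A.potential u x) / Real.exp (-φ x) *
    √(gramDet (A.metric u) x (extChartAt (𝓡 n) x x) / gramDet g x (extChartAt (𝓡 n) x x))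

/-- The renormalized volume coefficient `v_{k,φ} = (1 / k!) ∂_u^k v_φ` at `u = v = 0`. -/
def volumeCoeff (A : NormalAmbientSpace g φ) (k : ℕ) (x : M) : ℝ :=
  iteratedDeriv k (A.renormalizedVolume x) 0 / (Nat.factorial k : ℝ)

/-- The functional `𝓕_{k,φ} = ∫_M v_{k,φ} e^{-φ} dvol_g`. -/
def functional [T2Space M] [SigmaCompactSpace M] [MeasurableSpace M]
    (A : NormalAmbientSpace g φ) (k : ℕ) : ℝ :=
  ∫ x, A.volumeCoeff k x * Real.exp (-φ x) ∂(riemannianVolume g)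

/-! The vector field `X = v_{1,φ} ∂_v - ∂_u` on `ℝ × M × dom`, where `v_{1,φ}` is that of
`(M, g_u, φ_u)`, has the integral curves `t ↦ (w t x, x, -t)`; the structure
`(g_u, φ_u - v)` along the one with `w 0 x = 0` is `(g_{-t}, φ_{-t} - w t)`. -/

/-- The times for which the curves `t ↦ (w t x, x, -t)` stay in the ambient space. -/
def times (A : NormalAmbientSpace g φ) : Set ℝ := {t | -t ∈ A.dom}

/-- For every `x`, the curve `t ↦ (w t x, x, -t)`, `t ∈ A.times`, is the integral curve of
`X = v_{1,φ} ∂_v - ∂_u` that starts at `(0, x, 0)`. -/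
def IsIntegralFlow (A : NormalAmbientSpace g φ) (w : ℝ → M → ℝ) : Prop :=
  (∀ x, w 0 x = 0) ∧
  ∀ t ∈ A.times, ∀ x,
    HasDerivAt (fun s => w s x) (vOne (A.metric (-t)) (A.potential (-t)) x) t

/-- The metric along the integral curves of `X`. -/
def flowMetric (A : NormalAmbientSpace g φ) (t : ℝ) : Metric n M := A.metric (-t)

/-- The function `φ_u - v` along the integral curves of `X`. -/
def flowPotential (A : NormalAmbientSpace g φ) (w : ℝ → M → ℝ) (t : ℝ) (x : M) : ℝ :=
  A.potential (-t) x - w t x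

end NormalAmbientSpace

end Manifold

end WeightedAmbient

end

open WeightedAmbient

/-!
For `2 du dv + G_u` and `f_u - v`, the spatial components of the ambient Ricci equation and the
scalar equation reduce to
`½ ∂_u G = Ric_G + ∇²f` and `2 ∂_u f = ½ tr_G (∂_u G) - Δf + |∇f|²`.
They express the `u`-derivative of `(G, f)` through spatial derivatives of `(G, f)`, and spatial
derivatives preserve the vanishing order in `u`, so by induction `(g, φ)` determines the whole
Taylor expansion at `u = 0`. With `κ = 4μ`, the pair `(1 + κ u) g`, `(n / 4) log (1 + κ u) + c`
satisfies all ambient equations exactly; hence it is the only analytic solution, and every smooth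
one has its Taylor coefficients. In particular the renormalized volume of any normal ambient space
has the Taylor coefficients of `(1 + κ u) ^ (n / 4)`. Each `g_t` is again Einstein, with `μ`
replaced by `μ / (1 - 4μt)`, and the flow preserves `∫ e^{-φ} dvol`, so the functionals are
multiples of powers of `1 / (1 - 4μt)` by constants with the sign of `∏ (n - 4i)`.
-/

set_option maxSynthPendingDepth 3

namespace WeightedAmbient

open Filter Asymptotics Topology MeasureTheory

/-! ### Jets at `u = 0` -/

section Jets

variable {E W W' : Type*} [NormedAddCommGroup E] [NormedSpace ℝ E]
  [NormedAddCommGroup W] [NormedSpace ℝ W] [NormedAddCommGroup W'] [NormedSpace ℝ W']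

theorem isBigO_pow_succ_of_deriv {f : ℝ → W} {m : ℕ} (hf : ∀ᶠ u in 𝓝 0, DifferentiableAt ℝ f u)
    (h0 : f 0 = 0) (h : deriv f =O[𝓝 0] fun u : ℝ => u ^ m) :
    f =O[𝓝 0] fun u : ℝ => u ^ (m + 1) := by
  obtain ⟨C, hC, hbound⟩ := h.exists_nonneg
  obtain ⟨ε, hε, hball⟩ := Metric.eventually_nhds_iff_ball.1 (hf.and hbound.bound)
  refine IsBigO.of_bound C ?_
  filter_upwards [Metric.ball_mem_nhds (0 : ℝ) hε] with u hu
  have near {x : ℝ} (hx : x ∈ Metric.closedBall 0 |u|) : x ∈ Metric.ball 0 ε :=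
    (mem_closedBall_zero_iff.1 hx).trans_lt (by simpa using hu) |> mem_ball_zero_iff.2
  have deriv_le {x : ℝ} (hx : x ∈ Metric.closedBall 0 |u|) : ‖deriv f x‖ ≤ C * |u| ^ m := by
    refine (hball x (near hx)).2.trans ?_
    rw [norm_pow]
    gcongr
    exact mem_closedBall_zero_iff.1 hx
  have := (convex_closedBall (0 : ℝ) |u|).norm_image_sub_le_of_norm_deriv_le
    (fun x hx => (hball x (near hx)).1) (fun x hx => deriv_le hx)
    (x := 0) (y := u) (by simp) (by simp)
  simpa [h0, pow_succ, mul_assoc] using this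

theorem isBigO_pow_of_iteratedDeriv_eq_zero {f : ℝ → W} {m : ℕ} (hf : ContDiffAt ℝ ∞ f 0)
    (h : ∀ j < m, iteratedDeriv j f 0 = 0) : f =O[𝓝 0] fun u : ℝ => u ^ m := by
  induction m generalizing f with
  | zero => simpa using hf.continuousAt.isBigO_one ℝ
  | succ m ih =>
    have hf' : ∀ᶠ u in 𝓝 0, DifferentiableAt ℝ f u :=
      ((hf.of_le (m := 1) (by simp)).eventually (by simp)).mono
        fun u hu => hu.differentiableAt one_ne_zero
    refine isBigO_pow_succ_of_deriv hf' (by simpa using h 0 m.succ_pos)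
      (ih (ContDiffAt.derivWithin hf (by simp)) fun j hj => ?_)
    simpa only [← iteratedDeriv_succ'] using h (j + 1) (by omega)

theorem eq_zero_of_pow_smul_isBigO {c : W} {j : ℕ}
    (h : (fun u : ℝ => u ^ j • c) =O[𝓝 0] fun u : ℝ => u ^ (j + 1)) : c = 0 := by
  have h' : (fun u : ℝ => ContinuousMultilinearMap.mkPiRing ℝ (Fin j) c fun _ => u)
      =O[𝓝 0] fun u : ℝ => ‖u‖ ^ (j + 1) := by
    simpa [← norm_pow] using h.norm_right
  simpa using h'.continuousMultilinearMap_apply_eq_zero 1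

theorem iteratedDeriv_pow_smul_zero (i j : ℕ) (c : W) :
    iteratedDeriv i (fun u : ℝ => u ^ j • (j.factorial : ℝ)⁻¹ • c) 0 = if i = j then c else 0 := by
  rw [iteratedDeriv_smul_const (by fun_prop), iteratedDeriv_fun_pow_zero]
  split_ifs with hij
  · rw [smul_smul, mul_inv_cancel₀ (by exact_mod_cast j.factorial_ne_zero), one_smul]
  · simp

theorem iteratedDeriv_eq_zero_of_isBigO_pow {f : ℝ → W} {m : ℕ} (hf : ContDiffAt ℝ ∞ f 0)
    (h : f =O[𝓝 0] fun u : ℝ => u ^ m) : ∀ j < m, iteratedDeriv j f 0 = 0 := by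
  intro j
  induction j using Nat.strong_induction_on with
  | _ j ih =>
    intro hj
    set c := iteratedDeriv j f 0 with hc
    set p : ℝ → W := fun u => u ^ j • (j.factorial : ℝ)⁻¹ • c
    have hp_smooth : ContDiff ℝ ∞ p := by fun_prop
    have hfp : (fun u => f u - p u) =O[𝓝 0] fun u : ℝ => u ^ (j + 1) := by
      refine isBigO_pow_of_iteratedDeriv_eq_zero (hf.sub hp_smooth.contDiffAt) fun i hi => ?_
      rw [iteratedDeriv_fun_sub (contDiffAt_infty.1 hf i)
        (contDiffAt_infty.1 hp_smooth.contDiffAt i), iteratedDeriv_pow_smul_zero]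
      split_ifs with hij
      · rw [hij, ← hc, sub_self]
      · rw [ih i (by omega) (by omega), sub_zero]
    have hf' : f =O[𝓝 0] fun u : ℝ => u ^ (j + 1) :=
      h.trans <| (Nat.eq_or_lt_of_le hj).elim (fun hm => hm ▸ isBigO_refl _ _)
        fun hm => (isLittleO_pow_pow hm).isBigO
    have hpO : p =O[𝓝 0] fun u : ℝ => u ^ (j + 1) := by simpa using hf'.sub hfp
    simpa [j.factorial_ne_zero] using eq_zero_of_pow_smul_isBigO hpO

theorem isBigO_pow_deriv {f : ℝ → W} {m : ℕ} (hf : ContDiffAt ℝ ∞ f 0)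
    (h : f =O[𝓝 0] fun u : ℝ => u ^ (m + 1)) : deriv f =O[𝓝 0] fun u : ℝ => u ^ m := by
  refine isBigO_pow_of_iteratedDeriv_eq_zero (ContDiffAt.derivWithin hf (by simp)) fun j hj => ?_
  rw [← iteratedDeriv_succ']
  exact iteratedDeriv_eq_zero_of_isBigO_pow hf h _ (by omega)

theorem iteratedDeriv_eq_of_isBigO_pow {f g : ℝ → W} {k : ℕ} (hf : ContDiffAt ℝ ∞ f 0)
    (hg : ContDiffAt ℝ ∞ g 0) (h : (fun u => f u - g u) =O[𝓝 0] fun u : ℝ => u ^ (k + 1)) :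
    iteratedDeriv k f 0 = iteratedDeriv k g 0 := by
  have := iteratedDeriv_eq_zero_of_isBigO_pow (hf.sub hg) h k k.lt_succ_self
  rwa [iteratedDeriv_fun_sub (contDiffAt_infty.1 hf k) (contDiffAt_infty.1 hg k),
    sub_eq_zero] at this

/-- The partial derivative `∂_u F` of a function of `(x, u)`. -/
noncomputable def uDeriv (F : E × ℝ → W) (q : E × ℝ) : W := fderiv ℝ F q (0, 1)

theorem hasDerivAt_uDeriv {F : E × ℝ → W} {q : E × ℝ} (hF : DifferentiableAt ℝ F q) :
    HasDerivAt (fun u => F (q.1, u)) (uDeriv F q) q.2 :=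
  hF.hasFDerivAt.comp_hasDerivAt q.2 ((hasDerivAt_const q.2 q.1).prodMk (hasDerivAt_id q.2))

theorem hasFDerivAt_slice {F : E × ℝ → W} {q : E × ℝ} (hF : DifferentiableAt ℝ F q) :
    HasFDerivAt (fun x => F (x, q.2)) ((fderiv ℝ F q).comp (.inl ℝ E ℝ)) q.1 :=
  hF.hasFDerivAt.comp q.1 ((hasFDerivAt_id q.1).prodMk (hasFDerivAt_const q.2 q.1))

theorem contDiffAt_uDeriv {F : E × ℝ → W} {q : E × ℝ} {m n : ℕ∞ω} (hF : ContDiffAt ℝ n F q)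
    (hmn : m + 1 ≤ n) : ContDiffAt ℝ m (uDeriv F) q :=
  (hF.fderiv_right hmn).clm_apply contDiffAt_const

theorem hasDerivAt_fderiv_slice {F : E × ℝ → W} {q : E × ℝ} (hF : ContDiffAt ℝ 2 F q) :
    HasDerivAt (fun u => fderiv ℝ (fun x => F (x, u)) q.1)
      (fderiv ℝ (fun x => uDeriv F (x, q.2)) q.1) q.2 := by
  have hF' : DifferentiableAt ℝ (fderiv ℝ F) q :=
    (hF.fderiv_right (m := 1) one_add_one_eq_two.le).differentiableAt one_ne_zero
  have hslice : (fun u => fderiv ℝ (fun x => F (x, u)) q.1) =ᶠ[𝓝 q.2]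
      fun u => (fderiv ℝ F (q.1, u)).comp (.inl ℝ E ℝ) := by
    have hcont : Tendsto (fun u => (q.1, u)) (𝓝 q.2) (𝓝 q) :=
      (Continuous.prodMk_right q.1).continuousAt
    filter_upwards [hcont.eventually (hF.eventually (by simp))] with u hu
    exact (hasFDerivAt_slice (hu.differentiableAt two_ne_zero)).fderiv
  have hsymm : fderiv ℝ (fun x => uDeriv F (x, q.2)) q.1 =
      (uDeriv (fderiv ℝ F) q).comp (.inl ℝ E ℝ) := by
    have hdu : DifferentiableAt ℝ (uDeriv F) q := hF'.clm_apply (differentiableAt_const _)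
    rw [(hasFDerivAt_slice hdu).fderiv]
    ext x
    have hswap := (hF.isSymmSndFDerivAt (by simp)).eq (x, 0) (0, 1)
    change fderiv ℝ (fun z => fderiv ℝ F z (0, 1)) q (x, 0) = fderiv ℝ (fderiv ℝ F) q (0, 1) (x, 0)
    simpa [fderiv_clm_apply hF' (differentiableAt_const _)] using hswap
  rw [hsymm]
  exact (((ContinuousLinearMap.compL ℝ E (E × ℝ) W).flip (.inl ℝ E ℝ)).hasFDerivAt.comp_hasDerivAt
    q.2 (hasDerivAt_uDeriv hF')).congr_of_eventuallyEq hslice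

theorem contDiffAt_fderiv_slice {F : E × ℝ → W} {q : E × ℝ} {m n : ℕ∞ω} (hF : ContDiffAt ℝ n F q)
    (hmn : m + 1 ≤ n) :
    ContDiffAt ℝ m (fun p : E × ℝ => fderiv ℝ (fun x => F (x, p.2)) p.1) q :=
  ContDiffAt.fderiv (f := fun p x => F (x, p.2))
    (hF.comp (q, q.1) (contDiffAt_snd.prodMk (contDiffAt_snd.comp _ contDiffAt_fst)))
    contDiffAt_fst hmn

theorem tendsto_prodMk_nhds_zero {X : Type*} [TopologicalSpace X] (y : X) :
    Tendsto (fun u : ℝ => (y, u)) (𝓝 0) (𝓝 (y, 0)) :=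
  (Continuous.prodMk_right y).continuousAt

theorem isBigO_pow_fderiv_slice {F : E × ℝ → W} {y : E} {m : ℕ}
    (hF : ∀ᶠ x in 𝓝 y, ContDiffAt ℝ ∞ F (x, 0))
    (h : ∀ᶠ x in 𝓝 y, (fun u => F (x, u)) =O[𝓝 0] fun u : ℝ => u ^ m) :
    (fun u => fderiv ℝ (fun x => F (x, u)) y) =O[𝓝 0] fun u : ℝ => u ^ m := by
  induction m generalizing F with
  | zero =>
    have hcont := (contDiffAt_fderiv_slice (m := 0) hF.self_of_nhds (by simp)).continuousAt
    simpa using (hcont.tendsto.comp (tendsto_prodMk_nhds_zero y)).isBigO_one ℝ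
  | succ m ih =>
    have huDeriv : (fun u => fderiv ℝ (fun x => uDeriv F (x, u)) y) =O[𝓝 0] fun u => u ^ m := by
      refine ih (hF.mono fun x hx => contDiffAt_uDeriv hx (by simp)) ?_
      filter_upwards [hF, h] with x hFx hx
      have hslice : ContDiffAt ℝ ∞ (fun u => F (x, u)) 0 :=
        hFx.comp (0 : ℝ) (contDiffAt_const.prodMk contDiffAt_id)
      refine (isBigO_pow_deriv hslice hx).congr' ?_ EventuallyEq.rfl
      filter_upwards [(tendsto_prodMk_nhds_zero x).eventually
        ((hFx.of_le (m := 1) (by simp)).eventually (by simp))] with u hu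
      exact (hasDerivAt_uDeriv (hu.differentiableAt one_ne_zero)).deriv
    have hderiv : ∀ᶠ u in 𝓝 0, HasDerivAt (fun u => fderiv ℝ (fun x => F (x, u)) y)
        (fderiv ℝ (fun x => uDeriv F (x, u)) y) u := by
      filter_upwards [(tendsto_prodMk_nhds_zero y).eventually
        ((contDiffAt_infty.1 hF.self_of_nhds 2).eventually (by simp))] with u hu
      exact hasDerivAt_fderiv_slice hu
    have hzero : (fun x => F (x, 0)) =ᶠ[𝓝 y] fun _ => 0 :=
      h.mono fun x hx => hx.eq_zero_imp.self_of_nhds (by simp)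
    refine isBigO_pow_succ_of_deriv (hderiv.mono fun u hu => hu.differentiableAt) ?_
      (huDeriv.congr' (hderiv.mono fun u hu => hu.deriv.symm) EventuallyEq.rfl)
    rw [hzero.fderiv_eq, fderiv_const_apply]

end Jets

/-! ### Christoffel symbols of the ambient metric -/

section Coordinates

variable {V : Type*} [NormedAddCommGroup V] [NormedSpace ℝ V]

theorem fderiv_clm_apply₂ {E A B C : Type*} [NormedAddCommGroup E] [NormedSpace ℝ E]
    [NormedAddCommGroup A] [NormedSpace ℝ A] [NormedAddCommGroup B] [NormedSpace ℝ B]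
    [NormedAddCommGroup C] [NormedSpace ℝ C] {Γ : E → A →L[ℝ] B →L[ℝ] C} {x : E}
    (hΓ : DifferentiableAt ℝ Γ x) (X : E) (Y : A) (Z : B) :
    fderiv ℝ Γ x X Y Z = fderiv ℝ (fun w => Γ w Y Z) x X := by
  rw [((hΓ.hasFDerivAt.clm_apply (hasFDerivAt_const Y x)).clm_apply (hasFDerivAt_const Z x)).fderiv]
  simp

/-- The Christoffel symbols as a function of the value `b` and the derivative `D` of the metric. -/
noncomputable def christoffelOf (b : Bil V) (D : V →L[ℝ] V →L[ℝ] V →L[ℝ] ℝ) : V →L[ℝ] V →L[ℝ] V :=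
  let sharp := ContinuousLinearMap.compL ℝ V (V →L[ℝ] ℝ) V b.inverse
  (2⁻¹ : ℝ) • (sharp.comp D + sharp.comp D.flip -
    sharp.comp (((ContinuousLinearMap.flipₗᵢ ℝ V V ℝ).toContinuousLinearEquiv :
      (V →L[ℝ] V →L[ℝ] ℝ) →L[ℝ] (V →L[ℝ] V →L[ℝ] ℝ)).comp D.flip))

theorem christoffel_eq_christoffelOf (G : V → Bil V) (x : V) :
    christoffel G x = christoffelOf (G x) (fderiv ℝ G x) := rfl

theorem christoffel_congr {G G' : V → Bil V} {x : V} (h : G =ᶠ[𝓝 x] G') :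
    christoffel G x = christoffel G' x := by
  rw [christoffel_eq_christoffelOf, christoffel_eq_christoffelOf, h.fderiv_eq, h.eq_of_nhds]

theorem contDiffAt_christoffelOf [CompleteSpace V] {b : Bil V} (hb : b.IsInvertible)
    (D : V →L[ℝ] V →L[ℝ] V →L[ℝ] ℝ) {m : ℕ∞ω} :
    ContDiffAt ℝ m (fun p : Bil V × (V →L[ℝ] V →L[ℝ] V →L[ℝ] ℝ) => christoffelOf p.1 p.2)
      (b, D) := by
  have sharp : ContDiffAt ℝ m (fun p : Bil V × (V →L[ℝ] V →L[ℝ] V →L[ℝ] ℝ) =>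
      ContinuousLinearMap.compL ℝ V (V →L[ℝ] ℝ) V p.1.inverse) (b, D) :=
    (ContinuousLinearMap.contDiff _).contDiffAt.comp (b, D)
      (hb.contDiffAt_map_inverse.comp (b, D) contDiffAt_fst)
  have flip : ContDiffAt ℝ m (fun p : Bil V × (V →L[ℝ] V →L[ℝ] V →L[ℝ] ℝ) => p.2.flip) (b, D) :=
    (ContinuousLinearMap.flipₗᵢ ℝ V V (V →L[ℝ] ℝ)).contDiff.contDiffAt.comp (b, D) contDiffAt_snd
  exact (((sharp.clm_comp contDiffAt_snd).add (sharp.clm_comp flip)).sub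
    (sharp.clm_comp (contDiffAt_const.clm_comp flip))).const_smul _

theorem contDiffAt_christoffel [CompleteSpace V] {G : V → Bil V} {x : V} {m n : ℕ∞ω}
    (hG : ContDiffAt ℝ n G x) (hb : (G x).IsInvertible) (hmn : m + 1 ≤ n) :
    ContDiffAt ℝ m (christoffel G) x :=
  (contDiffAt_christoffelOf hb (fderiv ℝ G x)).comp (f := fun x => (G x, fderiv ℝ G x)) x
    ((hG.of_le (le_self_add.trans hmn)).prodMk (hG.fderiv_right hmn))

theorem contDiffAt_christoffel_slice [CompleteSpace V] {G : V × ℝ → Bil V} {q : V × ℝ}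
    {m n : ℕ∞ω} (hG : ContDiffAt ℝ n G q) (hb : (G q).IsInvertible) (hmn : m + 1 ≤ n) :
    ContDiffAt ℝ m (fun p : V × ℝ => christoffel (fun y => G (y, p.2)) p.1) q :=
  (contDiffAt_christoffelOf hb _).comp
    (f := fun p : V × ℝ => (G p, fderiv ℝ (fun y => G (y, p.2)) p.1)) q
    ((hG.of_le (le_self_add.trans hmn)).prodMk (contDiffAt_fderiv_slice hG hmn))

theorem eventually_isInvertible {X E F : Type*} [TopologicalSpace X] [NormedAddCommGroup E]
    [NormedSpace ℝ E] [CompleteSpace E] [NormedAddCommGroup F] [NormedSpace ℝ F]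
    {A : X → E →L[ℝ] F} {x : X} (hA : ContinuousAt A x) (hx : (A x).IsInvertible) :
    ∀ᶠ y in 𝓝 x, (A y).IsInvertible :=
  hA.eventually (ContinuousLinearEquiv.isOpen.mem_nhds hx)

/-- The ambient metric `2 du dv + G` in coordinates `(v, y, u)`. -/
noncomputable def warped (G : V × ℝ → Bil V) (z : ℝ × V × ℝ) : Bil (ℝ × V × ℝ) :=
  let dv : (ℝ × V × ℝ) →L[ℝ] ℝ := ContinuousLinearMap.fst ℝ ℝ (V × ℝ)
  let dy : (ℝ × V × ℝ) →L[ℝ] V :=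
    (ContinuousLinearMap.fst ℝ V ℝ).comp (ContinuousLinearMap.snd ℝ ℝ (V × ℝ))
  let du : (ℝ × V × ℝ) →L[ℝ] ℝ :=
    (ContinuousLinearMap.snd ℝ V ℝ).comp (ContinuousLinearMap.snd ℝ ℝ (V × ℝ))
  dv.smulRight du + du.smulRight dv + (G z.2).bilinearComp dy dy

theorem warped_apply (G : V × ℝ → Bil V) (z ξ η : ℝ × V × ℝ) :
    warped G z ξ η = ξ.1 * η.2.2 + ξ.2.2 * η.1 + G z.2 ξ.2.1 η.2.1 := by
  simp [warped]

variable (V) in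
/-- The inclusion of the tangent space of the middle factor of `ℝ × V × ℝ`. -/
noncomputable def inMid : V →L[ℝ] ℝ × V × ℝ :=
  (ContinuousLinearMap.inr ℝ ℝ (V × ℝ)).comp (ContinuousLinearMap.inl ℝ V ℝ)

@[simp] theorem inMid_apply (x : V) : inMid V x = (0, x, 0) := rfl

variable (V) in
/-- The projection to the tangent space of the middle factor of `ℝ × V × ℝ`. -/
noncomputable def projMid : (ℝ × V × ℝ) →L[ℝ] V :=
  (ContinuousLinearMap.fst ℝ V ℝ).comp (ContinuousLinearMap.snd ℝ ℝ (V × ℝ))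

@[simp] theorem projMid_apply (ξ : ℝ × V × ℝ) : projMid V ξ = ξ.2.1 := rfl

variable (V) in
/-- Pullback of bilinear forms along `projMid`. -/
noncomputable def pullMid : Bil V →L[ℝ] Bil (ℝ × V × ℝ) :=
  (((ContinuousLinearMap.compL ℝ (ℝ × V × ℝ) V ℝ).flip (projMid V)).postcomp (ℝ × V × ℝ)).comp
    (ContinuousLinearMap.precomp (V →L[ℝ] ℝ) (projMid V))

@[simp] theorem pullMid_apply (b : Bil V) (ξ η : ℝ × V × ℝ) :
    pullMid V b ξ η = b ξ.2.1 η.2.1 := rfl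

theorem warped_eq_add (G : V × ℝ → Bil V) : warped G = fun z => warped 0 0 + pullMid V (G z.2) := by
  ext1 z
  refine ContinuousLinearMap.ext fun ξ => ContinuousLinearMap.ext fun η => ?_
  simp [warped_apply]

theorem contDiffAt_warped {G : V × ℝ → Bil V} {z : ℝ × V × ℝ} {m : ℕ∞ω}
    (hG : ContDiffAt ℝ m G z.2) : ContDiffAt ℝ m (warped G) z := by
  rw [warped_eq_add]
  exact contDiffAt_const.add ((pullMid V).contDiff.contDiffAt.comp z (hG.comp z contDiffAt_snd))

/-- The inverse of the form `2 du dv + b`, as a map from covectors to vectors. -/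
noncomputable def warpedInverse (b : Bil V) : ((ℝ × V × ℝ) →L[ℝ] ℝ) →L[ℝ] ℝ × V × ℝ :=
  (ContinuousLinearMap.apply ℝ ℝ (0, 0, 1)).prod
    ((b.inverse.comp ((inMid V).precomp ℝ)).prod (ContinuousLinearMap.apply ℝ ℝ (1, 0, 0)))

theorem warpedInverse_apply (b : Bil V) (θ : (ℝ × V × ℝ) →L[ℝ] ℝ) :
    warpedInverse b θ = (θ (0, 0, 1), b.inverse (θ.comp (inMid V)), θ (1, 0, 0)) := rfl

theorem eq_add_inMid_add (ξ : ℝ × V × ℝ) :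
    ξ = ξ.1 • (1, 0, 0) + inMid V ξ.2.1 + ξ.2.2 • (0, 0, 1) := by
  ext <;> simp

section Inverse

variable {G : V × ℝ → Bil V} {z : ℝ × V × ℝ}

theorem warped_comp_warpedInverse (hb : (G z.2).IsInvertible) :
    (warped G z).comp (warpedInverse (G z.2)) = .id ℝ _ := by
  refine ContinuousLinearMap.ext fun θ => ContinuousLinearMap.ext fun η => ?_
  conv_rhs => rw [eq_add_inMid_add η]
  simp only [ContinuousLinearMap.comp_apply, warpedInverse_apply, warped_apply,
    hb.self_apply_inverse, ContinuousLinearMap.id_apply, map_add, map_smul, smul_eq_mul]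
  ring

theorem warpedInverse_comp_warped (hb : (G z.2).IsInvertible) :
    (warpedInverse (G z.2)).comp (warped G z) = .id ℝ _ := by
  refine ContinuousLinearMap.ext fun ξ => ?_
  have : (warped G z ξ).comp (inMid V) = G z.2 ξ.2.1 := by
    ext x; simp [warped_apply]
  rw [ContinuousLinearMap.comp_apply, warpedInverse_apply, this, hb.inverse_apply_self]
  ext <;> simp [warped_apply]

theorem isInvertible_warped (hb : (G z.2).IsInvertible) : (warped G z).IsInvertible :=
  .of_inverse (warped_comp_warpedInverse hb) (warpedInverse_comp_warped hb)

theorem inverse_warped (hb : (G z.2).IsInvertible) (θ : (ℝ × V × ℝ) →L[ℝ] ℝ) :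
    (warped G z).inverse θ = (θ (0, 0, 1), (G z.2).inverse (θ.comp (inMid V)), θ (1, 0, 0)) := by
  rw [ContinuousLinearMap.inverse_eq (warped_comp_warpedInverse hb) (warpedInverse_comp_warped hb),
    warpedInverse_apply]

end Inverse

theorem fderiv_eq_slice_add {W : Type*} [NormedAddCommGroup W] [NormedSpace ℝ W] {F : V × ℝ → W}
    {q : V × ℝ} (hF : DifferentiableAt ℝ F q) (a : V × ℝ) :
    fderiv ℝ F q a = fderiv ℝ (fun x => F (x, q.2)) q.1 a.1 + a.2 • uDeriv F q := by
  rw [(hasFDerivAt_slice hF).fderiv, uDeriv, ContinuousLinearMap.comp_apply, ← map_smul, ← map_add]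
  simp

variable {G : V × ℝ → Bil V} {z : ℝ × V × ℝ}

theorem fderiv_warped (hG : DifferentiableAt ℝ G z.2) (ζ ξ η : ℝ × V × ℝ) :
    fderiv ℝ (warped G) z ζ ξ η =
      fderiv ℝ (fun y => G (y, z.2.2)) z.2.1 ζ.2.1 ξ.2.1 η.2.1 +
        ζ.2.2 * uDeriv G z.2 ξ.2.1 η.2.1 := by
  have h : HasFDerivAt (warped G)
      ((pullMid V).comp ((fderiv ℝ G z.2).comp (ContinuousLinearMap.snd ℝ ℝ (V × ℝ)))) z := by
    rw [warped_eq_add]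
    exact ((pullMid V).hasFDerivAt.comp z (hG.hasFDerivAt.comp z hasFDerivAt_snd)).const_add _
  rw [h.fderiv]
  simp [fderiv_eq_slice_add hG]

theorem christoffel_warped (hG : DifferentiableAt ℝ G z.2) (hb : (G z.2).IsInvertible)
    (ξ η : ℝ × V × ℝ) :
    christoffel (warped G) z ξ η = (-(2⁻¹ * uDeriv G z.2 ξ.2.1 η.2.1),
      christoffel (fun y => G (y, z.2.2)) z.2.1 ξ.2.1 η.2.1 +
        (2⁻¹ : ℝ) • (G z.2).inverse (ξ.2.2 • uDeriv G z.2 η.2.1 + η.2.2 • uDeriv G z.2 ξ.2.1),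
      0) := by
  set D := fderiv ℝ (fun y => G (y, z.2.2)) z.2.1 with hD
  set θ : (ℝ × V × ℝ) →L[ℝ] ℝ := fderiv ℝ (warped G) z ξ η + fderiv ℝ (warped G) z η ξ -
    ((fderiv ℝ (warped G) z).flip ξ).flip η with hθ
  set τ : V →L[ℝ] ℝ := D ξ.2.1 η.2.1 + D η.2.1 ξ.2.1 - (D.flip ξ.2.1).flip η.2.1 with hτ
  have hmid : θ.comp (inMid V) = τ + (ξ.2.2 • uDeriv G z.2 η.2.1 + η.2.2 • uDeriv G z.2 ξ.2.1) := by
    ext x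
    simp only [hθ, hτ, ContinuousLinearMap.sub_comp, ContinuousLinearMap.add_comp, sub_apply,
      add_apply, ContinuousLinearMap.comp_apply, inMid_apply, fderiv_warped hG, ← hD,
      ContinuousLinearMap.flip_apply, zero_mul, add_zero, smul_apply, smul_eq_mul]
    ring
  rw [christoffel_apply (warped G) z ξ η θ (fun Z => by simp [hθ]), inverse_warped hb, hmid,
    christoffel_apply (fun y => G (y, z.2.2)) z.2.1 ξ.2.1 η.2.1 τ (fun Z => by simp [hτ, hD])]
  ext <;> simp [hθ, fderiv_warped hG]

theorem eventually_christoffel_warped [CompleteSpace V] (hG : ContDiffAt ℝ 1 G z.2)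
    (hb : (G z.2).IsInvertible) : ∀ᶠ w in 𝓝 z, ∀ ξ η : ℝ × V × ℝ,
    christoffel (warped G) w ξ η = (-(2⁻¹ * uDeriv G w.2 ξ.2.1 η.2.1),
      christoffel (fun y => G (y, w.2.2)) w.2.1 ξ.2.1 η.2.1 +
        (2⁻¹ : ℝ) • (G w.2).inverse (ξ.2.2 • uDeriv G w.2 η.2.1 + η.2.2 • uDeriv G w.2 ξ.2.1),
      0) := by
  filter_upwards [continuousAt_snd.eventually (hG.eventually (by simp)),
    continuousAt_snd.eventually (eventually_isInvertible hG.continuousAt hb)] with w hGw hbw ξ η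
  exact christoffel_warped (hGw.differentiableAt one_ne_zero) hbw ξ η

end Coordinates

/-! ### Curvature of the ambient metric -/

section AmbientCurvature

variable {V : Type*} [NormedAddCommGroup V] [NormedSpace ℝ V]

theorem ricci_apply (G : V → Bil V) (x Y Z : V) :
    ricci G x Y Z = LinearMap.trace ℝ V (curvatureEnd G x Y Z : V →ₗ[ℝ] V) := rfl

theorem curvatureEnd_apply (G : V → Bil V) (x X Y Z : V) :
    curvatureEnd G x Y Z X = fderiv ℝ (christoffel G) x X Y Z - fderiv ℝ (christoffel G) x Y X Z +
      christoffel G x X (christoffel G x Y Z) - christoffel G x Y (christoffel G x X Z) := rfl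

theorem hessian_apply (G : V → Bil V) (f : V → ℝ) (x X Y : V) :
    hessian G f x X Y = fderiv ℝ (fderiv ℝ f) x X Y - fderiv ℝ f x (christoffel G x X Y) := rfl

theorem trace_eq_trace_mid [FiniteDimensional ℝ V] (T : (ℝ × V × ℝ) →ₗ[ℝ] ℝ × V × ℝ)
    (S : V →ₗ[ℝ] V) (hv : T (1, 0, 0) = 0) (hu : ∀ ξ, (T ξ).2.2 = 0)
    (hS : ∀ x, (T (0, x, 0)).2.1 = S x) : LinearMap.trace ℝ _ T = LinearMap.trace ℝ V S := by
  let ι : V →ₗ[ℝ] ℝ × V × ℝ := inMid V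
  let π : (ℝ × V × ℝ) →ₗ[ℝ] V := projMid V
  let υ : (ℝ × V × ℝ) →ₗ[ℝ] ℝ := LinearMap.snd ℝ V ℝ ∘ₗ LinearMap.snd ℝ ℝ (V × ℝ)
  have hT : T = (T ∘ₗ ι) ∘ₗ π + υ.smulRight (T (0, 0, 1)) := by
    refine LinearMap.ext fun ξ => ?_
    conv_lhs => rw [eq_add_inMid_add ξ]
    rw [map_add, map_add, map_smul, map_smul, hv]
    simp [π, υ, ι]
  have hS' : S = π ∘ₗ (T ∘ₗ ι) := by
    ext x; simp [← hS, π, ι]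
  rw [hT, map_add, LinearMap.trace_smulRight, LinearMap.trace_comp_comm', hS']
  simp [υ, hu]

variable {G : V × ℝ → Bil V} {z : ℝ × V × ℝ} {f : V × ℝ → ℝ}

theorem fderiv_sub_fst (hf : DifferentiableAt ℝ f z.2) :
    fderiv ℝ (fun w : ℝ × V × ℝ => f w.2 - w.1) z =
      (fderiv ℝ f z.2).comp (.snd ℝ ℝ (V × ℝ)) - .fst ℝ ℝ (V × ℝ) :=
  ((hf.hasFDerivAt.comp z hasFDerivAt_snd).sub hasFDerivAt_fst).fderiv

theorem fderiv_fderiv_sub_fst (hf : ContDiffAt ℝ 2 f z.2) (ξ η : ℝ × V × ℝ) :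
    fderiv ℝ (fderiv ℝ fun w : ℝ × V × ℝ => f w.2 - w.1) z ξ η =
      fderiv ℝ (fderiv ℝ f) z.2 ξ.2 η.2 := by
  have hfst : (fderiv ℝ fun w : ℝ × V × ℝ => f w.2 - w.1) =ᶠ[𝓝 z] fun w =>
      (ContinuousLinearMap.snd ℝ ℝ (V × ℝ)).precomp ℝ (fderiv ℝ f w.2) -
        ContinuousLinearMap.fst ℝ ℝ (V × ℝ) :=
    (continuousAt_snd.eventually (hf.eventually (by simp))).mono
      fun w hw => fderiv_sub_fst (hw.differentiableAt two_ne_zero)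
  have hf' : DifferentiableAt ℝ (fderiv ℝ f) z.2 :=
    (hf.fderiv_right (m := 1) one_add_one_eq_two.le).differentiableAt one_ne_zero
  have hsnd : HasFDerivAt (fun w : ℝ × V × ℝ => fderiv ℝ f w.2) _ z :=
    hf'.hasFDerivAt.comp z hasFDerivAt_snd
  have hpre : HasFDerivAt (fun w : ℝ × V × ℝ =>
      (ContinuousLinearMap.snd ℝ ℝ (V × ℝ)).precomp ℝ (fderiv ℝ f w.2) -
        ContinuousLinearMap.fst ℝ ℝ (V × ℝ)) _ z :=
    (((ContinuousLinearMap.snd ℝ ℝ (V × ℝ)).precomp ℝ).hasFDerivAt.comp z hsnd).sub_const _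
  rw [hfst.fderiv_eq, hpre.fderiv]
  rfl

theorem fderiv_fderiv_slice {q : V × ℝ} (hf : ContDiffAt ℝ 2 f q) (X Y : V) :
    fderiv ℝ (fderiv ℝ fun y => f (y, q.2)) q.1 X Y =
      fderiv ℝ (fderiv ℝ f) q (X, 0) (Y, 0) := by
  have hslice : (fderiv ℝ fun y => f (y, q.2)) =ᶠ[𝓝 q.1] fun y =>
      (ContinuousLinearMap.inl ℝ V ℝ).precomp ℝ (fderiv ℝ f (y, q.2)) := by
    have hcont : Tendsto (fun y => (y, q.2)) (𝓝 q.1) (𝓝 q) :=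
      (Continuous.prodMk_left q.2).continuousAt
    filter_upwards [hcont.eventually (hf.eventually (by simp))] with y hy
    exact (hasFDerivAt_slice (hy.differentiableAt two_ne_zero)).fderiv
  have hf' : DifferentiableAt ℝ (fderiv ℝ f) q :=
    (hf.fderiv_right (m := 1) one_add_one_eq_two.le).differentiableAt one_ne_zero
  have hpre : HasFDerivAt (fun y => (ContinuousLinearMap.inl ℝ V ℝ).precomp ℝ (fderiv ℝ f (y, q.2)))
      _ q.1 :=
    ((ContinuousLinearMap.inl ℝ V ℝ).precomp ℝ).hasFDerivAt.comp q.1 (hasFDerivAt_slice hf')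
  rw [hslice.fderiv_eq, hpre.fderiv]
  rfl

theorem hessian_warped (hG : DifferentiableAt ℝ G z.2) (hb : (G z.2).IsInvertible)
    (hf : ContDiffAt ℝ 2 f z.2) (ξ η : ℝ × V × ℝ) :
    hessian (warped G) (fun w => f w.2 - w.1) z ξ η = fderiv ℝ (fderiv ℝ f) z.2 ξ.2 η.2 -
      fderiv ℝ f z.2 ((christoffel (warped G) z ξ η).2.1, 0) -
        2⁻¹ * uDeriv G z.2 ξ.2.1 η.2.1 := by
  rw [hessian_apply, fderiv_fderiv_sub_fst hf, fderiv_sub_fst (hf.differentiableAt two_ne_zero),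
    christoffel_warped hG hb]
  simp only [map_add, map_smul, smul_add, sub_apply, ContinuousLinearMap.comp_apply,
    ContinuousLinearMap.coe_snd', ContinuousLinearMap.coe_fst', sub_neg_eq_add]
  ring

theorem hessian_warped_mid (hG : DifferentiableAt ℝ G z.2) (hb : (G z.2).IsInvertible)
    (hf : ContDiffAt ℝ 2 f z.2) (X Y : V) :
    hessian (warped G) (fun w => f w.2 - w.1) z (0, X, 0) (0, Y, 0) =
      hessian (fun y => G (y, z.2.2)) (fun y => f (y, z.2.2)) z.2.1 X Y -
        2⁻¹ * uDeriv G z.2 X Y := by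
  rw [hessian_warped hG hb hf, hessian_apply, fderiv_fderiv_slice hf,
    (hasFDerivAt_slice (hf.differentiableAt two_ne_zero)).fderiv, christoffel_warped hG hb]
  simp

theorem hessian_warped_v (hG : DifferentiableAt ℝ G z.2) (hb : (G z.2).IsInvertible)
    (hf : ContDiffAt ℝ 2 f z.2) (η : ℝ × V × ℝ) :
    hessian (warped G) (fun w => f w.2 - w.1) z (1, 0, 0) η = 0 := by
  rw [hessian_warped hG hb hf, christoffel_warped hG hb]
  simp [show ((0 : V), (0 : ℝ)) = 0 from rfl]

theorem hessian_warped_v_right (hG : DifferentiableAt ℝ G z.2) (hb : (G z.2).IsInvertible)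
    (hf : ContDiffAt ℝ 2 f z.2) (ξ : ℝ × V × ℝ) :
    hessian (warped G) (fun w => f w.2 - w.1) z ξ (1, 0, 0) = 0 := by
  rw [hessian_warped hG hb hf, christoffel_warped hG hb]
  simp [show ((0 : V), (0 : ℝ)) = 0 from rfl]

theorem gradSq_warped (hb : (G z.2).IsInvertible) (hf : DifferentiableAt ℝ f z.2) :
    gradSq (warped G) (fun w => f w.2 - w.1) z =
      gradSq (fun y => G (y, z.2.2)) (fun y => f (y, z.2.2)) z.2.1 - 2 * uDeriv f z.2 := by
  have hmid : ((fderiv ℝ f z.2).comp (.snd ℝ ℝ (V × ℝ)) - .fst ℝ ℝ (V × ℝ)).comp (inMid V) =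
      (fderiv ℝ f z.2).comp (.inl ℝ V ℝ) := by
    ext x; simp
  rw [gradSq, gradSq, fderiv_sub_fst hf, inverse_warped hb, hmid, (hasFDerivAt_slice hf).fderiv]
  simp only [sub_apply, ContinuousLinearMap.comp_apply, ContinuousLinearMap.coe_snd',
    fderiv_eq_slice_add hf, map_zero, smul_eq_mul, one_mul, zero_add, ContinuousLinearMap.coe_fst',
    sub_zero, zero_mul, add_zero, zero_sub, neg_mul, Prod.mk.eta, ContinuousLinearMap.inl_apply]
  ring

section Complete

variable [CompleteSpace V]

theorem fderiv_christoffel_warped (hG : ContDiffAt ℝ 2 G z.2) (hb : (G z.2).IsInvertible)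
    {B : Type*} [NormedAddCommGroup B] [NormedSpace ℝ B] (p : (ℝ × V × ℝ) →L[ℝ] B) {k : V × ℝ → B}
    (hk : DifferentiableAt ℝ k z.2) {Y Z : ℝ × V × ℝ}
    (h : ∀ᶠ w in 𝓝 z, p (christoffel (warped G) w Y Z) = k w.2) (X : ℝ × V × ℝ) :
    p (fderiv ℝ (christoffel (warped G)) z X Y Z) = fderiv ℝ k z.2 X.2 := by
  have hΓ : DifferentiableAt ℝ (christoffel (warped G)) z :=
    (contDiffAt_christoffel (contDiffAt_warped hG) (isInvertible_warped hb)
      one_add_one_eq_two.le).differentiableAt one_ne_zero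
  have hΓYZ : DifferentiableAt ℝ (fun w => christoffel (warped G) w Y Z) z :=
    (hΓ.clm_apply (differentiableAt_const Y)).clm_apply (differentiableAt_const Z)
  rw [fderiv_clm_apply₂ hΓ, ← ContinuousLinearMap.comp_apply,
    ← (p.hasFDerivAt.comp z hΓYZ.hasFDerivAt).fderiv]
  have hk' : p ∘ (fun w => christoffel (warped G) w Y Z) =ᶠ[𝓝 z] k ∘ Prod.snd := h
  rw [hk'.fderiv_eq, (hk.hasFDerivAt.comp z hasFDerivAt_snd).fderiv]
  rfl

theorem fderiv_christoffel_warped_mid (hG : ContDiffAt ℝ 2 G z.2) (hb : (G z.2).IsInvertible)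
    (X Y Z : V) :
    (fderiv ℝ (christoffel (warped G)) z (0, X, 0) (0, Y, 0) (0, Z, 0)).2.1 =
      fderiv ℝ (christoffel fun y => G (y, z.2.2)) z.2.1 X Y Z := by
  have hΓ : DifferentiableAt ℝ (fun q : V × ℝ => christoffel (fun y => G (y, q.2)) q.1) z.2 :=
    (contDiffAt_christoffel_slice hG hb one_add_one_eq_two.le).differentiableAt one_ne_zero
  have hΓYZ : DifferentiableAt ℝ (fun q : V × ℝ => christoffel (fun y => G (y, q.2)) q.1 Y Z) z.2 :=
    (hΓ.clm_apply (differentiableAt_const Y)).clm_apply (differentiableAt_const Z)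
  have hmid := fderiv_christoffel_warped hG hb (projMid V) hΓYZ (Y := (0, Y, 0)) (Z := (0, Z, 0))
    ((eventually_christoffel_warped (hG.of_le one_le_two) hb).mono fun w hw => by simp [hw])
    (0, X, 0)
  rw [fderiv_clm_apply₂ (hasFDerivAt_slice hΓ).differentiableAt, (hasFDerivAt_slice hΓYZ).fderiv]
  exact hmid

theorem curvatureEnd_warped_v (hG : ContDiffAt ℝ 2 G z.2) (hb : (G z.2).IsInvertible)
    (Y Z : ℝ × V × ℝ) : curvatureEnd (warped G) z Y Z (1, 0, 0) = 0 := by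
  have hΓ := eventually_christoffel_warped (hG.of_le one_le_two) hb
  have hΓv : ∀ᶠ w in 𝓝 z, ∀ η, christoffel (warped G) w (1, 0, 0) η = 0 :=
    hΓ.mono fun w hw η => by rw [hw]; simp
  have hΓd : DifferentiableAt ℝ (christoffel (warped G)) (z.1, z.2) :=
    (contDiffAt_christoffel (contDiffAt_warped hG) (isInvertible_warped hb)
      one_add_one_eq_two.le).differentiableAt one_ne_zero
  have hk : DifferentiableAt ℝ (fun q => christoffel (warped G) (z.1, q) Y Z) z.2 :=
    ((hΓd.comp z.2 ((differentiableAt_const z.1).prodMk differentiableAt_id)).clm_apply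
      (differentiableAt_const Y)).clm_apply (differentiableAt_const Z)
  have hΓ_indep : ∀ᶠ w in 𝓝 z,
      christoffel (warped G) w Y Z = christoffel (warped G) (z.1, w.2) Y Z := by
    have hcont : Tendsto (fun w : ℝ × V × ℝ => (z.1, w.2)) (𝓝 z) (𝓝 z) :=
      (continuous_const.prodMk continuous_snd).continuousAt
    filter_upwards [hΓ, hcont.eventually hΓ] with w hw hw'
    rw [hw, hw']
  have dvΓ : fderiv ℝ (christoffel (warped G)) z (1, 0, 0) Y Z = 0 :=
    (fderiv_christoffel_warped hG hb (.id ℝ _) hk hΓ_indep (1, 0, 0)).trans (map_zero _)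
  have dΓv : fderiv ℝ (christoffel (warped G)) z Y (1, 0, 0) Z = 0 := by
    simpa using fderiv_christoffel_warped hG hb (.id ℝ _) (k := fun _ => 0)
      (differentiableAt_const _) (hΓv.mono fun w hw => hw Z) Y
  rw [curvatureEnd_apply, dvΓ, dΓv, hΓv.self_of_nhds, hΓv.self_of_nhds, map_zero]
  simp

theorem curvatureEnd_warped_u (hG : ContDiffAt ℝ 2 G z.2) (hb : (G z.2).IsInvertible)
    (X Y Z : ℝ × V × ℝ) : (curvatureEnd (warped G) z Y Z X).2.2 = 0 := by
  have hΓ := eventually_christoffel_warped (hG.of_le one_le_two) hb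
  have dΓ (X Y Z : ℝ × V × ℝ) : (fderiv ℝ (christoffel (warped G)) z X Y Z).2.2 = 0 := by
    simpa using fderiv_christoffel_warped hG hb (Y := Y) (Z := Z) (k := fun _ => 0)
      ((ContinuousLinearMap.snd ℝ V ℝ).comp (ContinuousLinearMap.snd ℝ ℝ (V × ℝ)))
      (differentiableAt_const _) (hΓ.mono fun w hw => by simp [hw]) X
  simp [curvatureEnd_apply, dΓ, hΓ.self_of_nhds]

end Complete

variable [FiniteDimensional ℝ V]

theorem ricci_warped_eq_trace (hG : ContDiffAt ℝ 2 G z.2) (hb : (G z.2).IsInvertible)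
    (Y Z : ℝ × V × ℝ) (T : V →ₗ[ℝ] V)
    (hT : ∀ x, (curvatureEnd (warped G) z Y Z (0, x, 0)).2.1 = T x) :
    ricci (warped G) z Y Z = LinearMap.trace ℝ V T :=
  have := FiniteDimensional.complete ℝ V
  trace_eq_trace_mid _ T (curvatureEnd_warped_v hG hb Y Z)
    (fun X => curvatureEnd_warped_u hG hb X Y Z) hT

theorem ricci_warped_mid (hG : ContDiffAt ℝ 2 G z.2) (hb : (G z.2).IsInvertible) (Y Z : V) :
    ricci (warped G) z (0, Y, 0) (0, Z, 0) = ricci (fun y => G (y, z.2.2)) z.2.1 Y Z := by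
  have := FiniteDimensional.complete ℝ V
  have hΓ := christoffel_warped (hG.differentiableAt two_ne_zero) hb
  refine ricci_warped_eq_trace hG hb _ _ _ fun x => ?_
  rw [ContinuousLinearMap.coe_coe, curvatureEnd_apply, curvatureEnd_apply]
  simp [fderiv_christoffel_warped_mid hG hb, hΓ]

theorem weightedRicci_warped_mid (hG : ContDiffAt ℝ 2 G z.2) (hb : (G z.2).IsInvertible)
    (hf : ContDiffAt ℝ 2 f z.2) (X Y : V) :
    weightedRicci (warped G) (fun w => f w.2 - w.1) z (0, X, 0) (0, Y, 0) =
      weightedRicci (fun y => G (y, z.2.2)) (fun y => f (y, z.2.2)) z.2.1 X Y -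
        2⁻¹ * uDeriv G z.2 X Y := by
  simp only [weightedRicci, LinearMap.add_apply]
  rw [ricci_warped_mid hG hb, hessian_warped_mid (hG.differentiableAt two_ne_zero) hb hf,
    add_sub_assoc]

theorem metricTrace_sub (b : Bil V) (S T : V →ₗ[ℝ] V →ₗ[ℝ] ℝ) :
    metricTrace b (S - T) = metricTrace b S - metricTrace b T := by
  simp only [metricTrace, LinearMap.comp_sub, map_sub]

theorem metricTrace_smul (b : Bil V) (a : ℝ) (T : V →ₗ[ℝ] V →ₗ[ℝ] ℝ) :
    metricTrace b (a • T) = a * metricTrace b T := by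
  simp only [metricTrace, LinearMap.comp_smul, map_smul, smul_eq_mul]

theorem laplacian_warped (hG : DifferentiableAt ℝ G z.2) (hb : (G z.2).IsInvertible)
    (hf : ContDiffAt ℝ 2 f z.2) :
    laplacian (warped G) (fun w => f w.2 - w.1) z =
      laplacian (fun y => G (y, z.2.2)) (fun y => f (y, z.2.2)) z.2.1 -
        2⁻¹ * metricTrace (G z.2) (uDeriv G z.2).toLinearMap₁₂ := by
  rw [laplacian, laplacian, ← metricTrace_smul, ← metricTrace_sub]
  refine trace_eq_trace_mid _ _ ?_ (fun ξ => ?_) fun x => ?_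
  · have : hessian (warped G) (fun w => f w.2 - w.1) z (1, 0, 0) = 0 :=
      LinearMap.ext fun η => hessian_warped_v hG hb hf η
    simp [this]
  · simp [inverse_warped hb, hessian_warped_v_right hG hb hf]
  · simp only [LinearMap.comp_apply, LinearEquiv.coe_coe, ContinuousLinearMap.coe_coe,
      inverse_warped hb]
    congr 1
    ext Y
    simp [hessian_warped_mid hG hb hf]

theorem weightedF_warped (hG : DifferentiableAt ℝ G z.2) (hb : (G z.2).IsInvertible)
    (hf : ContDiffAt ℝ 2 f z.2) :
    weightedF (warped G) (fun w => f w.2 - w.1) z =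
      weightedF (fun y => G (y, z.2.2)) (fun y => f (y, z.2.2)) z.2.1 -
        2⁻¹ * metricTrace (G z.2) (uDeriv G z.2).toLinearMap₁₂ + 2 * uDeriv f z.2 := by
  rw [weightedF, weightedF, laplacian_warped hG hb hf,
    gradSq_warped hb (hf.differentiableAt two_ne_zero)]
  ring

end AmbientCurvature

/-! ### The exact solution over an Einstein metric -/

section EinsteinModel

variable {V : Type*} [NormedAddCommGroup V] [NormedSpace ℝ V]

theorem christoffel_symm {G : V → Bil V} {x : V} (hd : DifferentiableAt ℝ G x)
    (hG : ∀ᶠ y in 𝓝 x, ∀ X Y, G y X Y = G y Y X) (X Y : V) :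
    christoffel G x X Y = christoffel G x Y X := by
  have hsymm (Z : V) : fderiv ℝ G x Z X Y = fderiv ℝ G x Z Y X := by
    rw [fderiv_clm_apply₂ hd, fderiv_clm_apply₂ hd]
    have hXY : (fun y => G y X Y) =ᶠ[𝓝 x] fun y => G y Y X := hG.mono fun y h => h X Y
    rw [hXY.fderiv_eq]
  set θ : V →L[ℝ] ℝ := fderiv ℝ G x X Y + fderiv ℝ G x Y X - ((fderiv ℝ G x).flip X).flip Y with hθ
  rw [christoffel_apply G x X Y θ (fun Z => by simp [hθ]),
    christoffel_apply G x Y X θ (fun Z => by simp [hθ, hsymm, add_comm])]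

theorem ricci_congr {G G' : V → Bil V} {x : V} (h : G =ᶠ[𝓝 x] G') : ricci G x = ricci G' x := by
  have hΓ : christoffel G =ᶠ[𝓝 x] christoffel G' :=
    h.eventuallyEq_nhds.mono fun _ hy => christoffel_congr hy
  ext Y Z
  rw [ricci_apply, ricci_apply, curvatureEnd, curvatureEnd, hΓ.fderiv_eq, hΓ.eq_of_nhds]

theorem hessian_congr {G G' : V → Bil V} {f f' : V → ℝ} {x : V} (hG : G =ᶠ[𝓝 x] G')
    (hf : f =ᶠ[𝓝 x] f') : hessian G f x = hessian G' f' x := by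
  have hdf : fderiv ℝ f =ᶠ[𝓝 x] fderiv ℝ f' := hf.fderiv
  ext X Y
  rw [hessian_apply, hessian_apply, christoffel_congr hG, hdf.fderiv_eq, hdf.eq_of_nhds]

theorem weightedRicci_congr {G G' : V → Bil V} {f f' : V → ℝ} {x : V} (hG : G =ᶠ[𝓝 x] G')
    (hf : f =ᶠ[𝓝 x] f') : weightedRicci G f x = weightedRicci G' f' x := by
  rw [weightedRicci, weightedRicci, ricci_congr hG, hessian_congr hG hf]

theorem weightedF_congr [FiniteDimensional ℝ V] {G G' : V → Bil V} {f f' : V → ℝ} {x : V}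
    (hG : G =ᶠ[𝓝 x] G') (hf : f =ᶠ[𝓝 x] f') : weightedF G f x = weightedF G' f' x := by
  rw [weightedF, weightedF, laplacian, laplacian, gradSq, gradSq, hessian_congr hG hf,
    hG.eq_of_nhds, hf.fderiv_eq]

theorem hessian_const (G : V → Bil V) (c : ℝ) (x : V) : hessian G (fun _ => c) x = 0 := by
  ext X Y
  simp [hessian_apply]

theorem laplacian_const [FiniteDimensional ℝ V] (G : V → Bil V) (c : ℝ) (x : V) :
    laplacian G (fun _ => c) x = 0 := by
  rw [laplacian, hessian_const, metricTrace, LinearMap.comp_zero, LinearMap.comp_zero, map_zero]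

theorem gradSq_const (G : V → Bil V) (c : ℝ) (x : V) : gradSq G (fun _ => c) x = 0 := by
  simp [gradSq]

theorem metricTrace_self [FiniteDimensional ℝ V] {b : Bil V} (hb : b.IsInvertible) :
    metricTrace b b.toLinearMap₁₂ = Module.finrank ℝ V := by
  have hid : (b.inverse : (V →L[ℝ] ℝ) →ₗ[ℝ] V) ∘ₗ
      (LinearMap.toContinuousLinearMap : (V →ₗ[ℝ] ℝ) ≃ₗ[ℝ] (V →L[ℝ] ℝ)).toLinearMap ∘ₗ
        b.toLinearMap₁₂ = LinearMap.id :=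
    LinearMap.ext fun X => hb.inverse_apply_self X
  rw [metricTrace, hid, LinearMap.trace_id]

theorem inverse_smul_apply {b : Bil V} (hb : b.IsInvertible) {a : ℝ} (ha : a ≠ 0)
    (θ : V →L[ℝ] ℝ) : (a • b).inverse θ = a⁻¹ • b.inverse θ := by
  have hright : (a • b).comp (a⁻¹ • b.inverse) = .id ℝ _ := by
    ext1 θ
    simp [smul_smul, ha, hb.self_apply_inverse]
  have hleft : (a⁻¹ • b.inverse).comp (a • b) = .id ℝ _ := by
    ext1 x
    simp [smul_smul, ha, hb.inverse_apply_self]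
  rw [ContinuousLinearMap.inverse_eq hright hleft]
  rfl

theorem isInvertible_smul {b : Bil V} (hb : b.IsInvertible) {a : ℝ} (ha : a ≠ 0) :
    (a • b).IsInvertible := by
  obtain ⟨e, rfl⟩ := hb
  exact ⟨e.trans (ContinuousLinearEquiv.smulLeft (Units.mk0 a ha)), by ext; simp⟩

theorem christoffel_smul {G : V → Bil V} {x : V} (hb : (G x).IsInvertible) {a : ℝ} (ha : a ≠ 0) :
    christoffel (fun y => a • G y) x = christoffel G x := by
  have hD : fderiv ℝ (fun y => a • G y) x = a • fderiv ℝ G x :=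
    congrFun (fderiv_const_smul_field a) x
  ext X Y
  set θ : V →L[ℝ] ℝ := fderiv ℝ G x X Y + fderiv ℝ G x Y X - ((fderiv ℝ G x).flip X).flip Y with hθ
  rw [christoffel_apply G x X Y θ (fun Z => by simp [hθ]),
    christoffel_apply (fun y => a • G y) x X Y (a • θ)
      (fun Z => by simp [hθ, hD, mul_add, mul_sub]),
    inverse_smul_apply hb ha]
  simp [smul_smul, ha]

theorem ricci_smul {G : V → Bil V} {x : V} (hb : ∀ᶠ y in 𝓝 x, (G y).IsInvertible) {a : ℝ}
    (ha : a ≠ 0) : ricci (fun y => a • G y) x = ricci G x := by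
  have hΓ : christoffel (fun y => a • G y) =ᶠ[𝓝 x] christoffel G :=
    hb.mono fun y hy => christoffel_smul hy ha
  ext Y Z
  rw [ricci_apply, ricci_apply, curvatureEnd, curvatureEnd, hΓ.fderiv_eq, hΓ.eq_of_nhds]

/-- The family of metrics `(1 + κ u) G₀` as a function of `(y, u)`. -/
noncomputable def modelMetric (κ : ℝ) (G₀ : V → Bil V) (q : V × ℝ) : Bil V :=
  (1 + κ * q.2) • G₀ q.1

variable (V) in
/-- The family of spatially constant functions `(dim V / 4) ln (1 + κ u) + c`, the potentials that
accompany `modelMetric`. -/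
noncomputable def modelPotential (κ c : ℝ) (q : V × ℝ) : ℝ :=
  Module.finrank ℝ V / 4 * Real.log (1 + κ * q.2) + c

variable {κ c : ℝ} {G₀ : V → Bil V}

section Slices

variable {q : V × ℝ}

theorem contDiffAt_modelMetric {m : ℕ∞ω} (hG₀ : ContDiffAt ℝ m G₀ q.1) :
    ContDiffAt ℝ m (modelMetric κ G₀) q := by
  have hfactor : ContDiffAt ℝ m (fun q : V × ℝ => 1 + κ * q.2) q := by fun_prop
  exact hfactor.smul (hG₀.comp q contDiffAt_fst)

theorem contDiffAt_modelPotential {m : ℕ∞ω} (ha : 1 + κ * q.2 ≠ 0) :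
    ContDiffAt ℝ m (modelPotential V κ c) q := by
  have harg : ContDiffAt ℝ m (fun q : V × ℝ => 1 + κ * q.2) q := by fun_prop
  exact (contDiffAt_const.mul (harg.log ha)).add contDiffAt_const

theorem differentiableAt_modelMetric (hG₀ : DifferentiableAt ℝ G₀ q.1) :
    DifferentiableAt ℝ (modelMetric κ G₀) q := by
  have hfactor : DifferentiableAt ℝ (fun q : V × ℝ => 1 + κ * q.2) q := by fun_prop
  exact hfactor.smul (hG₀.comp q differentiableAt_fst)

theorem uDeriv_modelMetric (hG₀ : DifferentiableAt ℝ G₀ q.1) :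
    uDeriv (modelMetric κ G₀) q = κ • G₀ q.1 := by
  have hlin : HasDerivAt (fun u => 1 + κ * u) κ q.2 := by
    simpa using ((hasDerivAt_id q.2).const_mul κ).const_add 1
  exact (hasDerivAt_uDeriv (differentiableAt_modelMetric hG₀)).unique (hlin.smul_const (G₀ q.1))

theorem hasFDerivAt_mul_div_one_add_mul (a : ℝ) (ha : 1 + κ * q.2 ≠ 0) :
    HasFDerivAt (fun r : V × ℝ => a * (κ / (1 + κ * r.2)))
      (-(a * (κ ^ 2 / (1 + κ * q.2) ^ 2)) • .snd ℝ V ℝ) q := by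
  have hlin : HasDerivAt (fun u => 1 + κ * u) κ q.2 := by
    simpa using ((hasDerivAt_id q.2).const_mul κ).const_add 1
  have hdiv : HasDerivAt (fun u => a * (κ / (1 + κ * u)))
      (-(a * (κ ^ 2 / (1 + κ * q.2) ^ 2))) q.2 :=
    (((hasDerivAt_const q.2 κ).div hlin ha).const_mul a).congr_deriv (by ring)
  exact hdiv.comp_hasFDerivAt q hasFDerivAt_snd

theorem fderiv_modelPotential (ha : 1 + κ * q.2 ≠ 0) :
    fderiv ℝ (modelPotential V κ c) q =
      (Module.finrank ℝ V / 4 * (κ / (1 + κ * q.2))) • .snd ℝ V ℝ := by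
  have hlin : HasDerivAt (fun u => 1 + κ * u) κ q.2 := by
    simpa using ((hasDerivAt_id q.2).const_mul κ).const_add 1
  exact ((((hlin.log ha).const_mul _).add_const c).comp_hasFDerivAt q hasFDerivAt_snd).fderiv

theorem fderiv_fderiv_modelPotential (ha : 1 + κ * q.2 ≠ 0) (X Y : V × ℝ) :
    fderiv ℝ (fderiv ℝ (modelPotential V κ c)) q X Y =
      -(Module.finrank ℝ V / 4 * (κ ^ 2 / (1 + κ * q.2) ^ 2) * (X.2 * Y.2)) := by
  have hne : ∀ᶠ r in 𝓝 q, 1 + κ * r.2 ≠ 0 :=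
    ContinuousAt.eventually_ne (by fun_prop) ha
  have hfst : fderiv ℝ (modelPotential V κ c) =ᶠ[𝓝 q] fun r =>
      (Module.finrank ℝ V / 4 * (κ / (1 + κ * r.2))) • .snd ℝ V ℝ :=
    hne.mono fun r hr => fderiv_modelPotential hr
  rw [hfst.fderiv_eq, ((hasFDerivAt_mul_div_one_add_mul _ ha).smul_const
    (ContinuousLinearMap.snd ℝ V ℝ)).fderiv]
  simp [mul_assoc]

end Slices

section Ambient

variable {z : ℝ × V × ℝ}

theorem christoffel_warped_modelMetric (hG₀ : DifferentiableAt ℝ G₀ z.2.1)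
    (hb : (G₀ z.2.1).IsInvertible) (ha : 1 + κ * z.2.2 ≠ 0) (ξ η : ℝ × V × ℝ) :
    christoffel (warped (modelMetric κ G₀)) z ξ η =
      (-(2⁻¹ * (κ * G₀ z.2.1 ξ.2.1 η.2.1)),
        christoffel G₀ z.2.1 ξ.2.1 η.2.1 +
          (2⁻¹ * (κ / (1 + κ * z.2.2))) • (ξ.2.2 • η.2.1 + η.2.2 • ξ.2.1), 0) := by
  have hslice : christoffel (fun y => modelMetric κ G₀ (y, z.2.2)) z.2.1 =
      christoffel G₀ z.2.1 := christoffel_smul hb ha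
  rw [christoffel_warped (differentiableAt_modelMetric hG₀) (isInvertible_smul hb ha), hslice,
    uDeriv_modelMetric hG₀, modelMetric, inverse_smul_apply hb ha]
  simp only [smul_apply, smul_eq_mul, map_add, map_smul, hb.inverse_apply_self, smul_add, smul_smul]
  congr 4 <;> congr 1 <;> ring

theorem fderiv_christoffel_warped_modelMetric [CompleteSpace V] (hG₀ : ContDiffAt ℝ 2 G₀ z.2.1)
    (hb : (G₀ z.2.1).IsInvertible) (ha : 1 + κ * z.2.2 ≠ 0) (X Y Z : ℝ × V × ℝ) :
    (fderiv ℝ (christoffel (warped (modelMetric κ G₀))) z X Y Z).2.1 =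
      fderiv ℝ (christoffel G₀) z.2.1 X.2.1 Y.2.1 Z.2.1 -
        (2⁻¹ * (κ ^ 2 / (1 + κ * z.2.2) ^ 2) * X.2.2) • (Y.2.2 • Z.2.1 + Z.2.2 • Y.2.1) := by
  have hΓ : DifferentiableAt ℝ (christoffel G₀) z.2.1 :=
    (contDiffAt_christoffel hG₀ hb one_add_one_eq_two.le).differentiableAt one_ne_zero
  have hΓYZ : HasFDerivAt (fun q : V × ℝ => christoffel G₀ q.1 Y.2.1 Z.2.1) _ z.2 :=
    ((hΓ.clm_apply (differentiableAt_const Y.2.1)).clm_apply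
      (differentiableAt_const Z.2.1)).hasFDerivAt.comp z.2 hasFDerivAt_fst
  have hk := hΓYZ.add ((hasFDerivAt_mul_div_one_add_mul 2⁻¹ ha).smul_const
    (Y.2.2 • Z.2.1 + Z.2.2 • Y.2.1))
  have hΓw : ∀ᶠ w in 𝓝 z, projMid V (christoffel (warped (modelMetric κ G₀)) w Y Z) =
      christoffel G₀ w.2.1 Y.2.1 Z.2.1 +
        (2⁻¹ * (κ / (1 + κ * w.2.2))) • (Y.2.2 • Z.2.1 + Z.2.2 • Y.2.1) := by
    have hy : Tendsto (fun w : ℝ × V × ℝ => w.2.1) (𝓝 z) (𝓝 z.2.1) :=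
      ContinuousAt.fst continuousAt_snd
    have hne : ∀ᶠ w : ℝ × V × ℝ in 𝓝 z, 1 + κ * w.2.2 ≠ 0 :=
      ContinuousAt.eventually_ne (by fun_prop) ha
    filter_upwards [hy.eventually (hG₀.eventually (by simp)),
      hy.eventually (eventually_isInvertible hG₀.continuousAt hb), hne] with w hw hbw haw
    rw [christoffel_warped_modelMetric (hw.differentiableAt two_ne_zero) hbw haw, projMid_apply]
  refine (fderiv_christoffel_warped (contDiffAt_modelMetric hG₀) (isInvertible_smul hb ha)
    (projMid V) hk.differentiableAt hΓw X).trans ?_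
  rw [hk.fderiv, fderiv_clm_apply₂ hΓ]
  simp [sub_eq_add_neg, mul_comm, add_comm]

theorem hessian_warped_model (hG₀ : DifferentiableAt ℝ G₀ z.2.1) (hb : (G₀ z.2.1).IsInvertible)
    (ha : 1 + κ * z.2.2 ≠ 0) (ξ η : ℝ × V × ℝ) :
    hessian (warped (modelMetric κ G₀)) (fun w => modelPotential V κ c w.2 - w.1) z ξ η =
      -(Module.finrank ℝ V / 4 * (κ ^ 2 / (1 + κ * z.2.2) ^ 2) * (ξ.2.2 * η.2.2)) -
        κ / 2 * G₀ z.2.1 ξ.2.1 η.2.1 := by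
  rw [hessian_warped (differentiableAt_modelMetric hG₀) (isInvertible_smul hb ha)
    (contDiffAt_modelPotential ha), fderiv_fderiv_modelPotential ha, fderiv_modelPotential ha,
    uDeriv_modelMetric hG₀]
  simp only [smul_apply, ContinuousLinearMap.coe_snd', smul_eq_mul]
  ring

variable [FiniteDimensional ℝ V]

theorem ricci_warped_modelMetric (hG₀ : ContDiffAt ℝ 2 G₀ z.2.1) (hb : (G₀ z.2.1).IsInvertible)
    (hs : ∀ᶠ y in 𝓝 z.2.1, ∀ X Y, G₀ y X Y = G₀ y Y X) (ha : 1 + κ * z.2.2 ≠ 0)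
    (Y Z : ℝ × V × ℝ) :
    ricci (warped (modelMetric κ G₀)) z Y Z = ricci G₀ z.2.1 Y.2.1 Z.2.1 +
      Module.finrank ℝ V / 4 * (κ ^ 2 / (1 + κ * z.2.2) ^ 2) * (Y.2.2 * Z.2.2) := by
  have := FiniteDimensional.complete ℝ V
  have hΓ := christoffel_warped_modelMetric (hG₀.differentiableAt two_ne_zero) hb ha
  have hΓ_symm := christoffel_symm (hG₀.differentiableAt two_ne_zero) hs
  rw [ricci_warped_eq_trace (contDiffAt_modelMetric hG₀) (isInvertible_smul hb ha) Y Z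
    ((curvatureEnd G₀ z.2.1 Y.2.1 Z.2.1 : V →ₗ[ℝ] V) +
      (4⁻¹ * (κ ^ 2 / (1 + κ * z.2.2) ^ 2) * (Y.2.2 * Z.2.2)) • LinearMap.id) fun X => ?_,
    map_add, map_smul, ← ricci_apply, LinearMap.trace_id, smul_eq_mul]
  · ring
  · rw [curvatureEnd_apply]
    simp only [Prod.snd_sub, Prod.snd_add, Prod.fst_sub, Prod.fst_add, hΓ,
      fderiv_christoffel_warped_modelMetric hG₀ hb ha]
    rw [LinearMap.add_apply, ContinuousLinearMap.coe_coe, curvatureEnd_apply]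
    simp only [map_add, map_smul, LinearMap.smul_apply, LinearMap.id_apply, hΓ_symm X Y.2.1]
    match_scalars <;> field_simp <;> ring

theorem weightedRicci_warped_model (hG₀ : ContDiffAt ℝ 2 G₀ z.2.1) (hb : (G₀ z.2.1).IsInvertible)
    (hs : ∀ᶠ y in 𝓝 z.2.1, ∀ X Y, G₀ y X Y = G₀ y Y X) (ha : 1 + κ * z.2.2 ≠ 0)
    (hE : ∀ X Y, ricci G₀ z.2.1 X Y = κ / 2 * G₀ z.2.1 X Y) (ξ η : ℝ × V × ℝ) :
    weightedRicci (warped (modelMetric κ G₀)) (fun w => modelPotential V κ c w.2 - w.1) z ξ η =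
      0 := by
  rw [weightedRicci, LinearMap.add_apply, LinearMap.add_apply,
    ricci_warped_modelMetric hG₀ hb hs ha, hE,
    hessian_warped_model (hG₀.differentiableAt two_ne_zero) hb ha]
  ring

theorem weightedF_warped_model (hG₀ : DifferentiableAt ℝ G₀ z.2.1) (hb : (G₀ z.2.1).IsInvertible)
    (ha : 1 + κ * z.2.2 ≠ 0) :
    weightedF (warped (modelMetric κ G₀)) (fun w => modelPotential V κ c w.2 - w.1) z = 0 := by
  have hf : (fun y => modelPotential V κ c (y, z.2.2)) = fun _ => modelPotential V κ c (0, z.2.2) :=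
    rfl
  have hdu : uDeriv (modelMetric κ G₀) z.2 = (κ / (1 + κ * z.2.2)) • modelMetric κ G₀ z.2 := by
    rw [uDeriv_modelMetric hG₀, modelMetric, smul_smul, div_mul_cancel₀ _ ha]
  have hb' : (modelMetric κ G₀ z.2).IsInvertible := isInvertible_smul hb ha
  rw [weightedF_warped (differentiableAt_modelMetric hG₀) hb'
    (contDiffAt_modelPotential ha), hf, weightedF, laplacian_const, gradSq_const, hdu, map_smul,
    metricTrace_smul, metricTrace_self hb', uDeriv, fderiv_modelPotential ha]
  simp only [smul_apply, ContinuousLinearMap.coe_snd', smul_eq_mul]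
  ring

end Ambient

end EinsteinModel

/-! ### Formal uniqueness -/

section FormalUniqueness

variable {V W W' : Type*} [NormedAddCommGroup V] [NormedSpace ℝ V]
  [NormedAddCommGroup W] [NormedSpace ℝ W] [NormedAddCommGroup W'] [NormedSpace ℝ W']

/-- `F` and `F'` are smooth along `u = 0` over `U`, and there they agree to order `m` in `u`. -/
structure JetEqOn (U : Set V) (m : ℕ) (F F' : V × ℝ → W) : Prop where
  contDiffAt_left : ∀ y ∈ U, ContDiffAt ℝ ∞ F (y, 0)
  contDiffAt_right : ∀ y ∈ U, ContDiffAt ℝ ∞ F' (y, 0)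
  isBigO : ∀ y ∈ U, (fun u => F (y, u) - F' (y, u)) =O[𝓝 0] fun u : ℝ => u ^ (m + 1)

theorem eventually_contDiffAt_two {F : V × ℝ → W} {y : V} (hF : ContDiffAt ℝ ∞ F (y, 0)) :
    ∀ᶠ u in 𝓝 (0 : ℝ), ContDiffAt ℝ 2 F (y, u) :=
  (tendsto_prodMk_nhds_zero y).eventually ((contDiffAt_infty.1 hF 2).eventually (by simp))

namespace JetEqOn

variable {U : Set V} {m : ℕ} {F F' : V × ℝ → W}

theorem apply_zero_eq (h : JetEqOn U m F F') {y : V} (hy : y ∈ U) : F (y, 0) = F' (y, 0) :=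
  sub_eq_zero.1 ((h.isBigO y hy).eq_zero_imp.self_of_nhds (by simp))

protected theorem comp (h : JetEqOn U m F F') {Φ : W → W'}
    (hΦ : ∀ y ∈ U, ContDiffAt ℝ ∞ Φ (F (y, 0))) :
    JetEqOn U m (Φ ∘ F) (Φ ∘ F') where
  contDiffAt_left y hy := (hΦ y hy).comp (y, 0) (h.contDiffAt_left y hy)
  contDiffAt_right y hy := by
    have hΦ' := hΦ y hy
    rw [h.apply_zero_eq hy] at hΦ'
    exact hΦ'.comp (y, 0) (h.contDiffAt_right y hy)
  isBigO y hy := by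
    have hlim : Tendsto (fun u => (F (y, u), F' (y, u))) (𝓝 0) (𝓝 (F (y, 0), F (y, 0))) := by
      refine ((h.contDiffAt_left y hy).continuousAt.tendsto.comp
        (tendsto_prodMk_nhds_zero y)).prodMk_nhds ?_
      rw [h.apply_zero_eq hy]
      exact (h.contDiffAt_right y hy).continuousAt.tendsto.comp (tendsto_prodMk_nhds_zero y)
    exact (((hΦ y hy).hasStrictFDerivAt (by simp)).isBigO_sub.comp_tendsto hlim).trans
      (h.isBigO y hy)

protected theorem prodMk (h : JetEqOn U m F F') {H H' : V × ℝ → W'} (h' : JetEqOn U m H H') :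
    JetEqOn U m (fun q => (F q, H q)) fun q => (F' q, H' q) where
  contDiffAt_left y hy := (h.contDiffAt_left y hy).prodMk (h'.contDiffAt_left y hy)
  contDiffAt_right y hy := (h.contDiffAt_right y hy).prodMk (h'.contDiffAt_right y hy)
  isBigO y hy := (h.isBigO y hy).prod_left (h'.isBigO y hy)

theorem fderiv_slice (h : JetEqOn U m F F') (hU : IsOpen U) :
    JetEqOn U m (fun q => fderiv ℝ (fun x => F (x, q.2)) q.1)
      fun q => fderiv ℝ (fun x => F' (x, q.2)) q.1 where
  contDiffAt_left y hy := contDiffAt_fderiv_slice (h.contDiffAt_left y hy) (by simp)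
  contDiffAt_right y hy := contDiffAt_fderiv_slice (h.contDiffAt_right y hy) (by simp)
  isBigO y hy := by
    have hsub := isBigO_pow_fderiv_slice (F := fun q => F q - F' q) (m := m + 1)
      (eventually_of_mem (hU.mem_nhds hy) fun x hx =>
        (h.contDiffAt_left x hx).sub (h.contDiffAt_right x hx))
      (eventually_of_mem (hU.mem_nhds hy) h.isBigO)
    refine hsub.congr' ?_ EventuallyEq.rfl
    filter_upwards [eventually_contDiffAt_two (h.contDiffAt_left y hy),
      eventually_contDiffAt_two (h.contDiffAt_right y hy)] with u hu hu'
    exact fderiv_fun_sub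
      (hasFDerivAt_slice (hu.differentiableAt two_ne_zero)).differentiableAt
      (hasFDerivAt_slice (hu'.differentiableAt two_ne_zero)).differentiableAt

theorem isBigO_of_uDeriv {y : V} (hF : ContDiffAt ℝ ∞ F (y, 0)) (hF' : ContDiffAt ℝ ∞ F' (y, 0))
    (h0 : F (y, 0) = F' (y, 0))
    (h : (fun u => uDeriv F (y, u) - uDeriv F' (y, u)) =O[𝓝 0] fun u : ℝ => u ^ m) :
    (fun u => F (y, u) - F' (y, u)) =O[𝓝 0] fun u : ℝ => u ^ (m + 1) := by
  have hderiv : ∀ᶠ u in 𝓝 0, HasDerivAt (fun u => F (y, u) - F' (y, u))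
      (uDeriv F (y, u) - uDeriv F' (y, u)) u := by
    filter_upwards [eventually_contDiffAt_two hF, eventually_contDiffAt_two hF'] with u hu hu'
    exact (hasDerivAt_uDeriv (hu.differentiableAt two_ne_zero)).sub
      (hasDerivAt_uDeriv (hu'.differentiableAt two_ne_zero))
  exact isBigO_pow_succ_of_deriv (hderiv.mono fun u hu => hu.differentiableAt) (sub_eq_zero.2 h0)
    (h.congr' (hderiv.mono fun u hu => hu.deriv.symm) EventuallyEq.rfl)

theorem of_apply_zero_eq (hF : ∀ y ∈ U, ContDiffAt ℝ ∞ F (y, 0))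
    (hF' : ∀ y ∈ U, ContDiffAt ℝ ∞ F' (y, 0))
    (h0 : ∀ y ∈ U, F (y, 0) = F' (y, 0)) : JetEqOn U 0 F F' where
  contDiffAt_left := hF
  contDiffAt_right := hF'
  isBigO y hy := by
    refine isBigO_of_uDeriv (hF y hy) (hF' y hy) (h0 y hy) ?_
    have hcont : ContinuousAt (fun q => uDeriv F q - uDeriv F' q) (y, (0 : ℝ)) :=
      (contDiffAt_uDeriv (m := 0) (hF y hy) (by simp)).continuousAt.sub
        (contDiffAt_uDeriv (m := 0) (hF' y hy) (by simp)).continuousAt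
    simpa using (hcont.tendsto.comp (tendsto_prodMk_nhds_zero y)).isBigO_one ℝ

theorem of_uDeriv (hF : ∀ y ∈ U, ContDiffAt ℝ ∞ F (y, 0)) (hF' : ∀ y ∈ U, ContDiffAt ℝ ∞ F' (y, 0))
    (h0 : ∀ y ∈ U, F (y, 0) = F' (y, 0)) (h : JetEqOn U m (uDeriv F) (uDeriv F')) :
    JetEqOn U (m + 1) F F' where
  contDiffAt_left := hF
  contDiffAt_right := hF'
  isBigO y hy := isBigO_of_uDeriv (hF y hy) (hF' y hy) (h0 y hy) (h.isBigO y hy)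

end JetEqOn

theorem isBigO_clm_of_apply [FiniteDimensional ℝ V] {α : Type*} {l : Filter α}
    {F : α → V →L[ℝ] W} {φ : α → ℝ} (h : ∀ X, (fun a => F a X) =O[l] φ) : F =O[l] φ := by
  obtain ⟨C, -, hC⟩ := (Module.finBasis ℝ V).exists_opNorm_le (F := W)
  set S : α → ℝ := fun a => ∑ i, ‖F a (Module.finBasis ℝ V i)‖
  have hS : S =O[l] φ := IsBigO.fun_sum fun i _ => (h _).norm_left
  refine IsBigO.trans (IsBigO.of_bound C (Eventually.of_forall fun a => ?_)) hS
  have hS_nonneg : 0 ≤ S a := Finset.sum_nonneg fun i _ => norm_nonneg _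
  rw [Real.norm_of_nonneg hS_nonneg]
  exact hC hS_nonneg fun i =>
    Finset.single_le_sum (f := fun i => ‖F a (Module.finBasis ℝ V i)‖)
      (fun i _ => norm_nonneg _) (Finset.mem_univ i)

variable (V) in
/-- The trace of an endomorphism, as a continuous linear form. -/
noncomputable def traceCLM [FiniteDimensional ℝ V] : (V →L[ℝ] V) →L[ℝ] ℝ :=
  LinearMap.toContinuousLinearMap (LinearMap.trace ℝ V ∘ₗ ContinuousLinearMap.coeLM ℝ)

/-- The Hessian as a function of the first and second derivatives of the function and the
Christoffel symbols. -/
noncomputable def hessianOf (p : (V →L[ℝ] ℝ) × Bil V × (V →L[ℝ] V →L[ℝ] V)) : Bil V :=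
  p.2.1 - (ContinuousLinearMap.compL ℝ V V ℝ p.1).comp p.2.2

/-- The curvature operator `X ↦ R(X, Y)Z` as a function of the Christoffel symbols and their
derivative. -/
noncomputable def curvatureOf (Y Z : V)
    (p : (V →L[ℝ] V →L[ℝ] V) × (V →L[ℝ] V →L[ℝ] V →L[ℝ] V)) : V →L[ℝ] V :=
  (p.2.flip Y).flip Z - (p.2 Y).flip Z + p.1.flip (p.1 Y Z) - (p.1 Y).comp (p.1.flip Z)

variable [FiniteDimensional ℝ V]

namespace JetEqOn

variable {U : Set V} {m : ℕ} {G G' : V × ℝ → Bil V} {f f' : V × ℝ → ℝ}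

protected theorem christoffel (h : JetEqOn U m G G') (hU : IsOpen U)
    (hb : ∀ y ∈ U, (G (y, 0)).IsInvertible) :
    JetEqOn U m (fun q => christoffel (fun x => G (x, q.2)) q.1)
      fun q => christoffel (fun x => G' (x, q.2)) q.1 :=
  have := FiniteDimensional.complete ℝ V
  (h.prodMk (h.fderiv_slice hU)).comp (Φ := fun p => christoffelOf p.1 p.2)
    fun y hy => contDiffAt_christoffelOf (hb y hy) _

protected theorem ricci (h : JetEqOn U m G G') (hU : IsOpen U)
    (hb : ∀ y ∈ U, (G (y, 0)).IsInvertible) (Y Z : V) :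
    JetEqOn U m (fun q => ricci (fun x => G (x, q.2)) q.1 Y Z)
      fun q => ricci (fun x => G' (x, q.2)) q.1 Y Z := by
  have hΓ := h.christoffel hU hb
  have hcurvature : ContDiff ℝ ∞ (curvatureOf Y Z) :=
    contDiff_clm_apply_iff.2 fun X => by
      simp only [curvatureOf, add_apply, sub_apply,
        ContinuousLinearMap.flip_apply, ContinuousLinearMap.comp_apply]
      fun_prop
  exact (hΓ.prodMk (hΓ.fderiv_slice hU)).comp (Φ := fun p => traceCLM V (curvatureOf Y Z p))
    fun y _ => ((traceCLM V).contDiff.comp hcurvature).contDiffAt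

protected theorem hessianOf (h : JetEqOn U m G G') (h' : JetEqOn U m f f') (hU : IsOpen U)
    (hb : ∀ y ∈ U, (G (y, 0)).IsInvertible) :
    JetEqOn U m
      (fun q => hessianOf (fderiv ℝ (fun x => f (x, q.2)) q.1,
        fderiv ℝ (fderiv ℝ fun x => f (x, q.2)) q.1,
        christoffel (fun x => G (x, q.2)) q.1))
      fun q => hessianOf (fderiv ℝ (fun x => f' (x, q.2)) q.1,
        fderiv ℝ (fderiv ℝ fun x => f' (x, q.2)) q.1,
        christoffel (fun x => G' (x, q.2)) q.1) :=
  have hdf := h'.fderiv_slice hU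
  have hsmooth : ContDiff ℝ ∞ (WeightedAmbient.hessianOf (V := V)) := by
    unfold WeightedAmbient.hessianOf
    fun_prop
  (hdf.prodMk ((hdf.fderiv_slice hU).prodMk (h.christoffel hU hb))).comp
    fun _ _ => hsmooth.contDiffAt

protected theorem inverse (h : JetEqOn U m G G') (hb : ∀ y ∈ U, (G (y, 0)).IsInvertible) :
    JetEqOn U m (fun q => (G q).inverse) fun q => (G' q).inverse :=
  have := FiniteDimensional.complete ℝ V
  h.comp (Φ := ContinuousLinearMap.inverse) fun y hy => (hb y hy).contDiffAt_map_inverse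

protected theorem metricTrace (h : JetEqOn U m G G') (hb : ∀ y ∈ U, (G (y, 0)).IsInvertible)
    {T T' : V × ℝ → Bil V} (hT : JetEqOn U m T T') :
    JetEqOn U m (fun q => metricTrace (G q) (T q).toLinearMap₁₂)
      fun q => metricTrace (G' q) (T' q).toLinearMap₁₂ :=
  ((h.inverse hb).prodMk hT).comp (Φ := fun p => traceCLM V (p.1.comp p.2))
    fun _ _ => ((traceCLM V).contDiff.comp (contDiff_fst.clm_comp contDiff_snd)).contDiffAt

protected theorem weightedRicci (h : JetEqOn U m G G') (h' : JetEqOn U m f f') (hU : IsOpen U)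
    (hb : ∀ y ∈ U, (G (y, 0)).IsInvertible) (X Y : V) :
    JetEqOn U m (fun q => weightedRicci (fun x => G (x, q.2)) (fun x => f (x, q.2)) q.1 X Y)
      fun q => weightedRicci (fun x => G' (x, q.2)) (fun x => f' (x, q.2)) q.1 X Y :=
  ((h.ricci hU hb X Y).prodMk (h.hessianOf h' hU hb)).comp (Φ := fun p => p.1 + p.2 X Y)
    fun _ _ => by fun_prop

protected theorem weightedF (h : JetEqOn U m G G') (h' : JetEqOn U m f f') (hU : IsOpen U)
    (hb : ∀ y ∈ U, (G (y, 0)).IsInvertible) :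
    JetEqOn U m (fun q => weightedF (fun x => G (x, q.2)) (fun x => f (x, q.2)) q.1)
      fun q => weightedF (fun x => G' (x, q.2)) (fun x => f' (x, q.2)) q.1 :=
  have hlaplacian := h.metricTrace hb (h.hessianOf h' hU hb)
  (hlaplacian.prodMk ((h.inverse hb).prodMk (h'.fderiv_slice hU))).comp
    (Φ := fun p => p.1 - p.2.2 (p.2.1 p.2.2)) fun _ _ => by fun_prop

end JetEqOn

/-- `(G, f)` is smooth and nondegenerate along `u = 0` over `U`, and there it solves to infinite
order in `u` those ambient equations that determine its jet: the components of `Ric + ∇²φ`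
tangent to the middle factor, and the scalar equation. -/
structure IsFormalSolution (U : Set V) (G : V × ℝ → Bil V) (f : V × ℝ → ℝ) : Prop where
  contDiffAt_metric : ∀ y ∈ U, ContDiffAt ℝ ∞ G (y, 0)
  contDiffAt_potential : ∀ y ∈ U, ContDiffAt ℝ ∞ f (y, 0)
  isInvertible : ∀ y ∈ U, (G (y, 0)).IsInvertible
  ricci_vanishes : ∀ y ∈ U, ∀ X Y : V, VanishesToInfiniteOrder fun u =>
    weightedRicci (warped G) (fun w => f w.2 - w.1) (0, y, u) (0, X, 0) (0, Y, 0)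
  F_vanishes : ∀ y ∈ U, VanishesToInfiniteOrder fun u =>
    weightedF (warped G) (fun w => f w.2 - w.1) (0, y, u)

namespace IsFormalSolution

variable {U : Set V} {G G' : V × ℝ → Bil V} {f f' : V × ℝ → ℝ}

theorem eventually_regular (h : IsFormalSolution U G f) {y : V} (hy : y ∈ U) :
    ∀ᶠ u in 𝓝 (0 : ℝ),
      ContDiffAt ℝ 2 G (y, u) ∧ ContDiffAt ℝ 2 f (y, u) ∧ (G (y, u)).IsInvertible := by
  have := FiniteDimensional.complete ℝ V
  have hG := h.contDiffAt_metric y hy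
  filter_upwards [eventually_contDiffAt_two hG,
    eventually_contDiffAt_two (h.contDiffAt_potential y hy),
    (tendsto_prodMk_nhds_zero y).eventually
      (eventually_isInvertible hG.continuousAt (h.isInvertible y hy))] with u hG hf hb
  exact ⟨hG, hf, hb⟩

theorem uDeriv_metric (h : IsFormalSolution U G f) {y : V} (hy : y ∈ U) (X Y : V) :
    VanishesToInfiniteOrder fun u => uDeriv G (y, u) X Y -
      2 * weightedRicci (fun x => G (x, u)) (fun x => f (x, u)) y X Y := by
  intro k
  refine ((h.ricci_vanishes y hy X Y k).const_mul_left (-2)).congr' ?_ EventuallyEq.rfl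
  filter_upwards [h.eventually_regular hy] with u hu
  rw [weightedRicci_warped_mid (z := (0, y, u)) hu.1 hu.2.2 hu.2.1]
  ring

theorem uDeriv_potential (h : IsFormalSolution U G f) {y : V} (hy : y ∈ U) :
    VanishesToInfiniteOrder fun u => uDeriv f (y, u) -
      (4⁻¹ * metricTrace (G (y, u)) (uDeriv G (y, u)).toLinearMap₁₂ -
        2⁻¹ * weightedF (fun x => G (x, u)) (fun x => f (x, u)) y) := by
  intro k
  refine ((h.F_vanishes y hy k).const_mul_left 2⁻¹).congr' ?_ EventuallyEq.rfl
  filter_upwards [h.eventually_regular hy] with u hu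
  rw [weightedF_warped (z := (0, y, u)) (hu.1.differentiableAt two_ne_zero) hu.2.2 hu.2.1]
  ring

theorem jetEqOn_uDeriv_metric (h : IsFormalSolution U G f) (h' : IsFormalSolution U G' f')
    (hU : IsOpen U) {m : ℕ} (hG : JetEqOn U m G G') (hf : JetEqOn U m f f') :
    JetEqOn U m (uDeriv G) (uDeriv G') where
  contDiffAt_left y hy := contDiffAt_uDeriv (h.contDiffAt_metric y hy) (by simp)
  contDiffAt_right y hy := contDiffAt_uDeriv (h'.contDiffAt_metric y hy) (by simp)
  isBigO y hy := isBigO_clm_of_apply fun X => isBigO_clm_of_apply fun Y => by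
    have hRic := ((hG.weightedRicci hf hU h.isInvertible X Y).isBigO y hy).const_mul_left 2
    refine (((h.uDeriv_metric hy X Y (m + 1)).sub (h'.uDeriv_metric hy X Y (m + 1))).add
      hRic).congr_left fun u => ?_
    simp only [sub_apply]
    ring

theorem jetEqOn_uDeriv_potential (h : IsFormalSolution U G f) (h' : IsFormalSolution U G' f')
    (hU : IsOpen U) {m : ℕ} (hG : JetEqOn U m G G') (hf : JetEqOn U m f f') :
    JetEqOn U m (uDeriv f) (uDeriv f') where
  contDiffAt_left y hy := contDiffAt_uDeriv (h.contDiffAt_potential y hy) (by simp)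
  contDiffAt_right y hy := contDiffAt_uDeriv (h'.contDiffAt_potential y hy) (by simp)
  isBigO y hy := by
    have hF := ((hG.weightedF hf hU h.isInvertible).isBigO y hy).const_mul_left 2⁻¹
    have htrace := ((hG.metricTrace h.isInvertible
      (h.jetEqOn_uDeriv_metric h' hU hG hf)).isBigO y hy).const_mul_left 4⁻¹
    refine ((((h.uDeriv_potential hy (m + 1)).sub (h'.uDeriv_potential hy (m + 1))).add
      htrace).sub hF).congr_left fun u => ?_
    ring

theorem jetEqOn (h : IsFormalSolution U G f) (h' : IsFormalSolution U G' f') (hU : IsOpen U)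
    (hG : ∀ y ∈ U, G (y, 0) = G' (y, 0)) (hf : ∀ y ∈ U, f (y, 0) = f' (y, 0)) (m : ℕ) :
    JetEqOn U m G G' ∧ JetEqOn U m f f' := by
  induction m with
  | zero =>
    exact ⟨.of_apply_zero_eq h.contDiffAt_metric h'.contDiffAt_metric hG,
      .of_apply_zero_eq h.contDiffAt_potential h'.contDiffAt_potential hf⟩
  | succ m ih =>
    exact ⟨.of_uDeriv h.contDiffAt_metric h'.contDiffAt_metric hG
        (h.jetEqOn_uDeriv_metric h' hU ih.1 ih.2),
      .of_uDeriv h.contDiffAt_potential h'.contDiffAt_potential hf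
        (h.jetEqOn_uDeriv_potential h' hU ih.1 ih.2)⟩

end IsFormalSolution

end FormalUniqueness

/-! ### Metrics in charts -/

section Charts

variable {n : ℕ} {M : Type*} [TopologicalSpace M] [ChartedSpace (Euc n) M] [IsManifold (𝓡 n) ∞ M]

theorem ambientMetric_eq_warped (g : ℝ → Metric n M) (p : M) :
    ambientMetric g p = warped fun q => coordMetric (g q.2) p q.1 := rfl

theorem coordMetric_apply (g : Metric n M) (p : M) (y X Y : Euc n) :
    coordMetric g p y X Y = g.inner ((extChartAt (𝓡 n) p).symm y)
      (mfderiv 𝓘(ℝ, Euc n) (𝓡 n) (extChartAt (𝓡 n) p).symm y X)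
      (mfderiv 𝓘(ℝ, Euc n) (𝓡 n) (extChartAt (𝓡 n) p).symm y Y) := rfl

theorem isInvertible_mfderiv_extChartAt_symm {p : M} {y : Euc n}
    (hy : y ∈ (extChartAt (𝓡 n) p).target) :
    (mfderiv 𝓘(ℝ, Euc n) (𝓡 n) (extChartAt (𝓡 n) p).symm y).IsInvertible := by
  have : IsManifold (𝓡 n) 1 M := .of_le (n := ∞) (by simp)
  have := isInvertible_mfderivWithin_extChartAt_symm (I := 𝓡 n) hy
  rwa [ModelWithCorners.range_eq_univ, mfderivWithin_univ] at this

theorem coordMetric_symm (g : Metric n M) (p : M) (y X Y : Euc n) :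
    coordMetric g p y X Y = coordMetric g p y Y X := by
  rw [coordMetric_apply, coordMetric_apply, g.symm]

theorem coordMetric_pos (g : Metric n M) {p : M} {y : Euc n}
    (hy : y ∈ (extChartAt (𝓡 n) p).target) {X : Euc n} (hX : X ≠ 0) :
    0 < coordMetric g p y X X := by
  refine g.pos _ _ fun h => hX ?_
  obtain ⟨e, he⟩ := isInvertible_mfderiv_extChartAt_symm hy
  rw [← he] at h
  exact e.map_eq_zero_iff.1 h

theorem isInvertible_of_pos {V : Type*} [NormedAddCommGroup V] [NormedSpace ℝ V]
    [FiniteDimensional ℝ V] {b : Bil V} (hb : ∀ X ≠ 0, 0 < b X X) : b.IsInvertible := by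
  have hinj : Function.Injective
      (LinearMap.toContinuousLinearMap.symm.toLinearMap ∘ₗ b.toLinearMap :
        V →ₗ[ℝ] Module.Dual ℝ V) := by
    refine (injective_iff_map_eq_zero _).2 fun X hX => ?_
    by_contra hX_ne
    exact (hb X hX_ne).ne' (LinearMap.congr_fun hX X)
  let e := LinearEquiv.ofInjectiveOfFinrankEq _ hinj (by rw [Subspace.dual_finrank_eq])
  exact ⟨(e.trans LinearMap.toContinuousLinearMap).toContinuousLinearEquiv, rfl⟩

theorem isInvertible_coordMetric (g : Metric n M) {p : M} {y : Euc n}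
    (hy : y ∈ (extChartAt (𝓡 n) p).target) : (coordMetric g p y).IsInvertible :=
  isInvertible_of_pos fun _ hX => coordMetric_pos g hy hX

theorem contMDiffOn_trivializationAt_symmL (p : M) (X : Euc n) :
    ContMDiffOn (𝓡 n) ((𝓡 n).prod 𝓘(ℝ, Euc n)) ∞
      (fun x => Bundle.TotalSpace.mk' (Euc n) (E := TangentSpace (𝓡 n)) x
        ((trivializationAt (Euc n) (TangentSpace (𝓡 n)) p).symmL ℝ x X))
      (chartAt (Euc n) p).source := by
  have : IsManifold (𝓡 n) 1 M := .of_le (n := ∞) (by simp)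
  have hconst : ContMDiffOn (𝓡 n) ((𝓡 n).prod 𝓘(ℝ, Euc n)) ∞
      (fun x : M => Bundle.TotalSpace.mk' (Euc n) (E := Bundle.Trivial M (Euc n)) x X)
      (chartAt (Euc n) p).source := fun x _ =>
    Bundle.contMDiffWithinAt_section.2 contMDiffWithinAt_const
  exact ContMDiffOn.clm_bundle_apply (b := fun x => x)
    ((trivializationAt (Euc n) (TangentSpace (𝓡 n)) p).contMDiffOn_symmL (n := ∞) (𝕜 := ℝ)
      (IB := 𝓡 n)) hconst

theorem contMDiffOn_inner_trivializationAt_symmL (g : Metric n M) (p : M) (X Y : Euc n) :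
    ContMDiffOn (𝓡 n) 𝓘(ℝ, ℝ) ∞
      (fun x => g.inner x ((trivializationAt (Euc n) (TangentSpace (𝓡 n)) p).symmL ℝ x X)
        ((trivializationAt (Euc n) (TangentSpace (𝓡 n)) p).symmL ℝ x Y))
      (chartAt (Euc n) p).source := fun x hx =>
  Bundle.contMDiffWithinAt_section.1 <|
    ContMDiffOn.clm_bundle_apply₂ (b := fun x => x) (F₃ := ℝ) (E₃ := Bundle.Trivial M ℝ)
      g.contMDiff.contMDiffOn (contMDiffOn_trivializationAt_symmL p X)
      (contMDiffOn_trivializationAt_symmL p Y) x hx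

theorem coordMetric_eq_inner_trivializationAt_symmL (g : Metric n M) {p : M} {y : Euc n}
    (hy : y ∈ (extChartAt (𝓡 n) p).target) (X Y : Euc n) :
    coordMetric g p y X Y = g.inner ((extChartAt (𝓡 n) p).symm y)
      ((trivializationAt (Euc n) (TangentSpace (𝓡 n)) p).symmL ℝ ((extChartAt (𝓡 n) p).symm y) X)
      ((trivializationAt (Euc n) (TangentSpace (𝓡 n)) p).symmL ℝ
        ((extChartAt (𝓡 n) p).symm y) Y) := by
  have : IsManifold (𝓡 n) 1 M := .of_le (n := ∞) (by simp)
  have hsource : (extChartAt (𝓡 n) p).symm y ∈ (chartAt (Euc n) p).source := by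
    simpa using (extChartAt (𝓡 n) p).map_target hy
  have hsymmL := TangentBundle.symmL_trivializationAt (𝕜 := ℝ) (I := 𝓡 n) hsource
  rw [(extChartAt (𝓡 n) p).right_inv hy, ModelWithCorners.range_eq_univ,
    mfderivWithin_univ] at hsymmL
  rw [coordMetric_apply, hsymmL]
  rfl

theorem contDiffOn_coordMetric (g : Metric n M) (p : M) :
    ContDiffOn ℝ ∞ (coordMetric g p) (extChartAt (𝓡 n) p).target := by
  refine contDiffOn_clm_apply.2 fun X => contDiffOn_clm_apply.2 fun Y => ?_
  have hcomp := (contMDiffOn_inner_trivializationAt_symmL g p X Y).comp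
    (contMDiffOn_extChartAt_symm (I := 𝓡 n) (n := ∞) p) fun y hy => by
      simpa using (extChartAt (𝓡 n) p).map_target hy
  exact (contMDiffOn_iff_contDiffOn.1 hcomp).congr fun y hy =>
    coordMetric_eq_inner_trivializationAt_symmL g hy X Y

theorem contDiffAt_coordMetric (g : Metric n M) {p : M} {y : Euc n}
    (hy : y ∈ (extChartAt (𝓡 n) p).target) : ContDiffAt ℝ ∞ (coordMetric g p) y :=
  (contDiffOn_coordMetric g p).contDiffAt ((isOpen_extChartAt_target p).mem_nhds hy)

theorem metric_ext {g g' : Metric n M} (h : ∀ x X Y, g.inner x X Y = g'.inner x X Y) :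
    g = g' := by
  have hinner : g.inner = g'.inner := by
    funext x
    ext X Y
    exact h x X Y
  cases g
  cases g'
  congr

theorem inner_eq_mul_of_coordMetric {g g' : Metric n M} {s : ℝ} {x : M}
    (h : ∀ X Y, coordMetric g x (extChartAt (𝓡 n) x x) X Y =
      s * coordMetric g' x (extChartAt (𝓡 n) x x) X Y) (X Y : TangentSpace (𝓡 n) x) :
    g.inner x X Y = s * g'.inner x X Y := by
  obtain ⟨e, he⟩ := isInvertible_mfderiv_extChartAt_symm (mem_extChartAt_target (I := 𝓡 n) x)
  have hsurj : Function.Surjective (α := Euc n)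
      (mfderiv 𝓘(ℝ, Euc n) (𝓡 n) (extChartAt (𝓡 n) x).symm (extChartAt (𝓡 n) x x)) :=
    he ▸ e.surjective
  let IsScaledAt : M → Prop := fun x =>
    ∀ X Y : TangentSpace (𝓡 n) x, g.inner x X Y = s * g'.inner x X Y
  have hscaled : IsScaledAt ((extChartAt (𝓡 n) x).symm (extChartAt (𝓡 n) x x)) := by
    intro X Y
    obtain ⟨X', rfl⟩ := hsurj X
    obtain ⟨Y', rfl⟩ := hsurj Y
    exact h X' Y'
  rw [extChartAt_to_inv] at hscaled
  exact hscaled X Y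

/-- The metric `s g`. -/
noncomputable def scaleMetric (g : Metric n M) (s : ℝ) (hs : 0 < s) : Metric n M where
  inner x := s • g.inner x
  symm x v w := by simp [g.symm x v w]
  pos x v hv := by simpa using mul_pos hs (g.pos x v hv)
  isVonNBounded x := by
    refine ((g.isVonNBounded x).image
      ((√s)⁻¹ • ContinuousLinearMap.id ℝ (TangentSpace (𝓡 n) x))).subset fun v hv => ?_
    have hs' : √s ≠ 0 := (Real.sqrt_pos.2 hs).ne'
    refine ⟨√s • v, ?_, by simp [smul_smul, hs']⟩
    have hscale : √s * (√s * g.inner x v v) = s * g.inner x v v := by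
      rw [← mul_assoc, Real.mul_self_sqrt hs.le]
    simpa [hscale] using hv
  contMDiff := g.contMDiff.const_smul_section

theorem scaleMetric_inner (g : Metric n M) {s : ℝ} (hs : 0 < s) (x : M)
    (X Y : TangentSpace (𝓡 n) x) : (scaleMetric g s hs).inner x X Y = s * g.inner x X Y := rfl

theorem coordMetric_scaleMetric (g : Metric n M) {s : ℝ} (hs : 0 < s) (p : M) (y : Euc n) :
    coordMetric (scaleMetric g s hs) p y = s • coordMetric g p y := rfl

end Charts

/-! ### The ambient space of an Einstein metric -/

section EinsteinAmbient

variable {n : ℕ} {M : Type*} [TopologicalSpace M] [ChartedSpace (Euc n) M] [IsManifold (𝓡 n) ∞ M]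

theorem isSmoothFamily_of_scaled {g : Metric n M} {J : Set ℝ} {a b : ℝ → ℝ}
    (ha : ContDiffOn ℝ ∞ a J) (hb : ContDiffOn ℝ ∞ b J) {gs : ℝ → Metric n M} {φ : ℝ → M → ℝ}
    (hg : ∀ u ∈ J, ∀ p : M, ∀ y ∈ (extChartAt (𝓡 n) p).target,
      coordMetric (gs u) p y = a u • coordMetric g p y)
    (hφ : ∀ u ∈ J, ∀ x, φ u x = b u) : IsSmoothFamily J gs φ := by
  refine fun p => ⟨?_, ?_⟩
  · exact ((ha.comp contDiffOn_snd fun z hz => hz.2).smul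
      ((contDiffOn_coordMetric g p).comp contDiffOn_fst fun z hz => hz.1)).congr
      fun z hz => hg z.2 hz.2 p z.1 hz.1
  · exact ContDiffOn.congr (hb.comp contDiffOn_snd fun z hz => hz.2)
      fun z hz => hφ z.2 hz.2 _

/-- The metric `(1 + κ u) g`, or the junk value `g` where the factor is not positive. -/
noncomputable def einsteinMetric (g : Metric n M) (κ u : ℝ) : Metric n M :=
  if h : 0 < 1 + κ * u then scaleMetric g (1 + κ * u) h else g

variable (M) in
/-- The potential `(n / 4) log (1 + κ u) + c`, constant on `M`. -/
noncomputable def einsteinPotential (n : ℕ) (κ c u : ℝ) : M → ℝ :=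
  fun _ => (n : ℝ) / 4 * Real.log (1 + κ * u) + c

theorem einsteinMetric_of_pos (g : Metric n M) {κ u : ℝ} (h : 0 < 1 + κ * u) :
    einsteinMetric g κ u = scaleMetric g (1 + κ * u) h := dif_pos h

theorem coordMetric_einsteinMetric (g : Metric n M) {κ u : ℝ} (h : 0 < 1 + κ * u) (p : M)
    (y : Euc n) : coordMetric (einsteinMetric g κ u) p y = (1 + κ * u) • coordMetric g p y := by
  rw [einsteinMetric_of_pos g h, coordMetric_scaleMetric]

theorem isOpen_one_add_mul_pos (κ : ℝ) : IsOpen {u : ℝ | 0 < 1 + κ * u} :=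
  isOpen_lt continuous_const (by fun_prop)

theorem eventually_one_add_mul_pos (κ : ℝ) : ∀ᶠ u in 𝓝 (0 : ℝ), 0 < 1 + κ * u :=
  (isOpen_one_add_mul_pos κ).mem_nhds (by simp)

theorem ordConnected_one_add_mul_pos (κ : ℝ) : {u : ℝ | 0 < 1 + κ * u}.OrdConnected := by
  refine Set.ordConnected_def.2 fun a (ha : 0 < 1 + κ * a) b (hb : 0 < 1 + κ * b) u hu => ?_
  change 0 < 1 + κ * u
  rcases le_total 0 κ with hκ | hκ
  · linarith [mul_le_mul_of_nonneg_left hu.1 hκ]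
  · linarith [mul_le_mul_of_nonpos_left hu.2 hκ]

theorem analyticOnNhd_log_one_add_mul (κ a c : ℝ) :
    AnalyticOnNhd ℝ (fun u : ℝ => a * Real.log (1 + κ * u) + c) {u | 0 < 1 + κ * u} :=
  fun u hu => by
    have haffine : AnalyticAt ℝ (fun u : ℝ => 1 + κ * u) u := by fun_prop
    exact (analyticAt_const.mul (haffine.log hu)).add analyticAt_const

theorem ambientMetric_einsteinMetric_eventuallyEq (g : Metric n M) {κ : ℝ} (p : M) {z : Amb n}
    (hz : 0 < 1 + κ * z.2.2) :
    ambientMetric (einsteinMetric g κ) p =ᶠ[𝓝 z] warped (modelMetric κ (coordMetric g p)) := by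
  have hopen : IsOpen {w : Amb n | 0 < 1 + κ * w.2.2} := isOpen_lt continuous_const (by fun_prop)
  filter_upwards [hopen.mem_nhds hz] with w hw
  rw [ambientMetric_eq_warped]
  simp only [warped, modelMetric, coordMetric_einsteinMetric g hw]

omit [IsManifold (𝓡 n) ∞ M] in
theorem ambientPotential_einsteinPotential (κ c : ℝ) (p : M) :
    ambientPotential (einsteinPotential M n κ c) p =
      fun w => modelPotential (Euc n) κ c w.2 - w.1 := by
  funext w
  rw [modelPotential, finrank_euclideanSpace_fin]
  rfl

theorem weightedRicci_einsteinAmbient {g : Metric n M} {κ : ℝ} (hg : IsEinstein g (κ / 2)) (c : ℝ)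
    (p : M) {z : Amb n} (hy : z.2.1 ∈ (extChartAt (𝓡 n) p).target) (hu : 0 < 1 + κ * z.2.2)
    (ξ η : Amb n) :
    weightedRicci (ambientMetric (einsteinMetric g κ) p)
      (ambientPotential (einsteinPotential M n κ c) p) z ξ η = 0 := by
  rw [weightedRicci_congr (ambientMetric_einsteinMetric_eventuallyEq g p hu)
    (ambientPotential_einsteinPotential κ c p).eventuallyEq]
  exact weightedRicci_warped_model (contDiffAt_infty.1 (contDiffAt_coordMetric g hy) 2)
    (isInvertible_coordMetric g hy) (.of_forall (coordMetric_symm g p)) hu.ne' (hg p _ hy) ξ η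

theorem weightedF_einsteinAmbient (g : Metric n M) {κ : ℝ} (c : ℝ) (p : M) {z : Amb n}
    (hy : z.2.1 ∈ (extChartAt (𝓡 n) p).target) (hu : 0 < 1 + κ * z.2.2) :
    weightedF (ambientMetric (einsteinMetric g κ) p)
      (ambientPotential (einsteinPotential M n κ c) p) z = 0 := by
  rw [weightedF_congr (ambientMetric_einsteinMetric_eventuallyEq g p hu)
    (ambientPotential_einsteinPotential κ c p).eventuallyEq]
  exact weightedF_warped_model ((contDiffAt_coordMetric g hy).differentiableAt (by simp))
    (isInvertible_coordMetric g hy) hu.ne'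

theorem vanishesToInfiniteOrder_of_eventually {r : ℝ → ℝ} (h : ∀ᶠ u in 𝓝 0, r u = 0) :
    VanishesToInfiniteOrder r := fun _ =>
  (isBigO_zero _ _).congr' (h.mono fun _ hu => hu.symm) EventuallyEq.rfl

/-- The explicit normal weighted ambient space of an Einstein metric with constant potential,
defined wherever `(1 + κ u) g` is a metric. -/
noncomputable def einsteinAmbient {g : Metric n M} {κ : ℝ} (hg : IsEinstein g (κ / 2)) (c : ℝ) :
    NormalAmbientSpace g (fun _ => c) where
  dom := {u | 0 < 1 + κ * u}
  isOpen_dom := isOpen_one_add_mul_pos κ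
  ordConnected_dom := ordConnected_one_add_mul_pos κ
  zero_mem_dom := (eventually_one_add_mul_pos κ).self_of_nhds
  metric := einsteinMetric g κ
  potential := einsteinPotential M n κ c
  metric_zero := by
    rw [einsteinMetric_of_pos g (by simp)]
    exact metric_ext fun x X Y => by simp [scaleMetric_inner]
  potential_zero := by funext x; simp [einsteinPotential]
  smooth := isSmoothFamily_of_scaled (g := g) (a := fun u => 1 + κ * u) (by fun_prop)
    ((analyticOnNhd_log_one_add_mul κ _ c).contDiffOn (isOpen_one_add_mul_pos κ).uniqueDiffOn)
    (fun u hu p y _ => coordMetric_einsteinMetric g hu p y) (fun _ _ _ => rfl)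
  ricci_vanishes p y hy v ξ η := vanishesToInfiniteOrder_of_eventually <|
    (eventually_one_add_mul_pos κ).mono fun u hu => weightedRicci_einsteinAmbient hg c p hy hu ξ η
  F_vanishes p y hy v := vanishesToInfiniteOrder_of_eventually <|
    (eventually_one_add_mul_pos κ).mono fun u hu => weightedF_einsteinAmbient g c p hy hu

theorem dom_einsteinAmbient {g : Metric n M} {κ : ℝ} (hg : IsEinstein g (κ / 2)) (c : ℝ)
    (hκ : 0 < κ) : (einsteinAmbient hg c).dom = Set.Ioi (-(1 / κ)) := by
  ext u
  rw [Set.mem_Ioi, neg_lt_iff_pos_add', ← mul_pos_iff_of_pos_left hκ, mul_add,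
    mul_one_div_cancel hκ.ne']
  rfl

theorem isGlobal_einsteinAmbient {g : Metric n M} {κ : ℝ} (hg : IsEinstein g (κ / 2)) (c : ℝ) :
    (einsteinAmbient hg c).IsGlobal := fun p _ hy _ _ hu =>
  ⟨weightedRicci_einsteinAmbient hg c p hy hu, weightedF_einsteinAmbient g c p hy hu⟩

theorem isAnalytic_einsteinAmbient {g : Metric n M} {κ : ℝ} (hg : IsEinstein g (κ / 2)) (c : ℝ) :
    (einsteinAmbient hg c).IsAnalytic := by
  refine fun x => ⟨fun X Y => ?_, analyticOnNhd_log_one_add_mul κ _ c⟩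
  have hlinear : AnalyticOnNhd ℝ (fun u => (1 + κ * u) * g.inner x X Y) {u | 0 < 1 + κ * u} :=
    fun u _ => by fun_prop
  refine hlinear.congr (isOpen_one_add_mul_pos κ) fun u (hu : 0 < 1 + κ * u) => ?_
  change _ = (einsteinMetric g κ u).inner x X Y
  rw [einsteinMetric_of_pos g hu, scaleMetric_inner]

end EinsteinAmbient

/-! ### Uniqueness of the volume coefficients -/

section VolumeCoeff

variable {n : ℕ} {M : Type*} [TopologicalSpace M] [ChartedSpace (Euc n) M] [IsManifold (𝓡 n) ∞ M]

theorem JetEqOn.iteratedDeriv_eq {V W : Type*} [NormedAddCommGroup V] [NormedSpace ℝ V]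
    [NormedAddCommGroup W] [NormedSpace ℝ W] {U : Set V} {k : ℕ} {F F' : V × ℝ → W}
    (h : JetEqOn U k F F') {y : V} (hy : y ∈ U) :
    iteratedDeriv k (fun u => F (y, u)) 0 = iteratedDeriv k (fun u => F' (y, u)) 0 :=
  iteratedDeriv_eq_of_isBigO_pow
    ((h.contDiffAt_left y hy).comp 0 (contDiffAt_const.prodMk contDiffAt_id))
    ((h.contDiffAt_right y hy).comp 0 (contDiffAt_const.prodMk contDiffAt_id)) (h.isBigO y hy)

/-- The determinant of the matrix of a bilinear form in the standard basis. -/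
noncomputable def bilDet (b : Bil (Euc n)) : ℝ :=
  Matrix.det <| Matrix.of fun i j : Fin n =>
    b (EuclideanSpace.single i 1) (EuclideanSpace.single j 1)

theorem gramDet_eq_bilDet (g : Metric n M) (p : M) (y : Euc n) :
    gramDet g p y = bilDet (coordMetric g p y) := rfl

theorem contDiff_bilDet : ContDiff ℝ ∞ (bilDet (n := n)) := by
  have hsum : bilDet (n := n) = fun b => ∑ σ : Equiv.Perm (Fin n), ((Equiv.Perm.sign σ : ℤ) : ℝ) *
      ∏ i, b (EuclideanSpace.single (σ i) 1) (EuclideanSpace.single i 1) := by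
    funext b
    simp only [bilDet, Matrix.det_apply', Matrix.of_apply]
  rw [hsum]
  fun_prop

theorem bilDet_smul (s : ℝ) (b : Bil (Euc n)) : bilDet (s • b) = s ^ n * bilDet b := by
  have hmatrix : (Matrix.of fun i j : Fin n => (s • b) (EuclideanSpace.single i 1)
      (EuclideanSpace.single j 1)) = s • Matrix.of fun i j : Fin n =>
      b (EuclideanSpace.single i 1) (EuclideanSpace.single j 1) := rfl
  rw [bilDet, hmatrix, Matrix.det_smul, Fintype.card_fin, bilDet]

theorem bilDet_pos {b : Bil (Euc n)} (hs : ∀ X Y, b X Y = b Y X) (hb : ∀ X ≠ 0, 0 < b X X) :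
    0 < bilDet b := by
  let e := EuclideanSpace.basisFun (Fin n) ℝ
  have hmatrix : Matrix.of (fun i j : Fin n => b (EuclideanSpace.single i 1)
      (EuclideanSpace.single j 1)) =
      LinearMap.toMatrix₂ e.toBasis e.toBasis b.toLinearMap₁₂ := by
    ext i j
    simp [e, LinearMap.toMatrix₂_apply]
  refine Matrix.PosDef.det_pos (.of_dotProduct_mulVec_pos ?_ fun v hv => ?_)
  · ext i j
    exact hs _ _
  · rw [hmatrix]
    exact (hb _ (e.toBasis.equivFun.symm.map_ne_zero_iff.2 hv)).trans_eq
      (dotProduct_toMatrix₂_mulVec e.toBasis e.toBasis b.toLinearMap₁₂ v v).symm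

theorem gramDet_pos (g : Metric n M) {p : M} {y : Euc n}
    (hy : y ∈ (extChartAt (𝓡 n) p).target) : 0 < gramDet g p y :=
  bilDet_pos (coordMetric_symm g p y) fun _ hX => coordMetric_pos g hy hX

theorem gramDet_scaleMetric (g : Metric n M) {s : ℝ} (hs : 0 < s) (p : M) (y : Euc n) :
    gramDet (scaleMetric g s hs) p y = s ^ n * gramDet g p y := by
  rw [gramDet_eq_bilDet, coordMetric_scaleMetric, bilDet_smul, gramDet_eq_bilDet]

/-- The renormalized volume at `x` as a function of the coordinate expression of `g_u` at `x` and
of the value of `φ_u` there. -/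
noncomputable def renormalizedDensity (g : Metric n M) (φ : M → ℝ) (x : M)
    (q : Bil (Euc n) × ℝ) : ℝ :=
  Real.exp (-q.2) / Real.exp (-φ x) * √(bilDet q.1 / gramDet g x (extChartAt (𝓡 n) x x))

theorem contDiffAt_renormalizedDensity (g : Metric n M) (φ : M → ℝ) (x : M) {q : Bil (Euc n) × ℝ}
    (hq : 0 < bilDet q.1) : ContDiffAt ℝ ∞ (renormalizedDensity g φ x) q := by
  have hd := gramDet_pos g (mem_extChartAt_target (I := 𝓡 n) x)
  refine ContDiffAt.mul (by fun_prop) (ContDiffAt.sqrt ?_ (div_pos hq hd).ne')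
  exact (contDiff_bilDet.contDiffAt.comp _ contDiffAt_fst).div_const _

namespace NormalAmbientSpace

variable {g : Metric n M} {φ : M → ℝ}

theorem isFormalSolution (A : NormalAmbientSpace g φ) (p : M) :
    IsFormalSolution (extChartAt (𝓡 n) p).target
      (fun q => coordMetric (A.metric q.2) p q.1) (fun q => coordFun (A.potential q.2) p q.1) where
  contDiffAt_metric _ hy := (A.smooth p).1.contDiffAt
    (prod_mem_nhds ((isOpen_extChartAt_target p).mem_nhds hy)
      (A.isOpen_dom.mem_nhds A.zero_mem_dom))
  contDiffAt_potential _ hy := (A.smooth p).2.contDiffAt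
    (prod_mem_nhds ((isOpen_extChartAt_target p).mem_nhds hy)
      (A.isOpen_dom.mem_nhds A.zero_mem_dom))
  isInvertible _ hy := isInvertible_coordMetric _ hy
  ricci_vanishes y hy _ _ := A.ricci_vanishes p y hy 0 _ _
  F_vanishes y hy := A.F_vanishes p y hy 0

theorem jetEqOn (A B : NormalAmbientSpace g φ) (p : M) (m : ℕ) :
    JetEqOn (extChartAt (𝓡 n) p).target m (fun q => coordMetric (A.metric q.2) p q.1)
      (fun q => coordMetric (B.metric q.2) p q.1) ∧
    JetEqOn (extChartAt (𝓡 n) p).target m (fun q => coordFun (A.potential q.2) p q.1)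
      (fun q => coordFun (B.potential q.2) p q.1) :=
  (A.isFormalSolution p).jetEqOn (B.isFormalSolution p) (isOpen_extChartAt_target p)
    (fun _ _ => by rw [A.metric_zero, B.metric_zero])
    (fun _ _ => by rw [A.potential_zero, B.potential_zero]) m

theorem renormalizedVolume_eq (A : NormalAmbientSpace g φ) (x : M) :
    A.renormalizedVolume x = fun u => renormalizedDensity g φ x
      (coordMetric (A.metric u) x (extChartAt (𝓡 n) x x),
        coordFun (A.potential u) x (extChartAt (𝓡 n) x x)) := by
  funext u
  rw [renormalizedVolume, renormalizedDensity, coordFun, extChartAt_to_inv, gramDet_eq_bilDet]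

theorem volumeCoeff_eq (A B : NormalAmbientSpace g φ) (k : ℕ) (x : M) :
    A.volumeCoeff k x = B.volumeCoeff k x := by
  obtain ⟨hmetric, hpotential⟩ := A.jetEqOn B x k
  have hdensity := (hmetric.prodMk hpotential).comp (Φ := renormalizedDensity g φ x) fun y hy =>
    contDiffAt_renormalizedDensity g φ x (gramDet_pos _ hy)
  rw [volumeCoeff, volumeCoeff, renormalizedVolume_eq, renormalizedVolume_eq]
  exact congrArg (· / _) (hdensity.iteratedDeriv_eq (mem_extChartAt_target x))

end NormalAmbientSpace

end VolumeCoeff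

/-! ### Volume coefficients of an Einstein metric -/

section EinsteinVolumeCoeff

theorem iteratedDeriv_one_add_mul_rpow (κ a : ℝ) (k : ℕ) {u : ℝ} (hu : 0 < 1 + κ * u) :
    iteratedDeriv k (fun u => (1 + κ * u) ^ a) u =
      κ ^ k * (∏ i ∈ Finset.range k, (a - i)) * (1 + κ * u) ^ (a - k) := by
  induction k generalizing u with
  | zero => simp
  | succ k ih =>
    have hprev : iteratedDeriv k (fun u => (1 + κ * u) ^ a) =ᶠ[𝓝 u] fun u =>
        κ ^ k * (∏ i ∈ Finset.range k, (a - i)) * (1 + κ * u) ^ (a - k) := by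
      filter_upwards [(isOpen_one_add_mul_pos κ).mem_nhds hu] with s hs using ih hs
    have haffine : HasDerivAt (fun u => 1 + κ * u) κ u := by
      simpa using ((hasDerivAt_id u).const_mul κ).const_add 1
    have hpow := (haffine.rpow_const (p := a - k) (Or.inl hu.ne')).const_mul
      (κ ^ k * (∏ i ∈ Finset.range k, (a - i)))
    rw [iteratedDeriv_succ, hprev.deriv_eq, hpow.deriv, Finset.prod_range_succ, Nat.cast_succ,
      ← sub_sub]
    ring

theorem exp_neg_mul_log_mul_sqrt_pow {a : ℝ} (ha : 0 < a) (b : ℝ) (n : ℕ) :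
    Real.exp (-(b * Real.log a)) * √(a ^ n) = a ^ ((n : ℝ) / 2 - b) := by
  rw [Real.rpow_def_of_pos ha, Real.sqrt_eq_rpow, ← Real.rpow_natCast, ← Real.rpow_mul ha.le,
    Real.rpow_def_of_pos ha, ← Real.exp_add]
  congr 1
  ring

theorem pow_mul_prod_div_four_sub (κ x : ℝ) (k : ℕ) :
    κ ^ k * ∏ i ∈ Finset.range k, (x / 4 - i) =
      (κ / 4) ^ k * ∏ i ∈ Finset.range k, (x - 4 * i) := by
  have hpow (a : ℝ) : a ^ k = ∏ _i ∈ Finset.range k, a := by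
    rw [Finset.prod_const, Finset.card_range]
  rw [hpow, hpow, ← Finset.prod_mul_distrib, ← Finset.prod_mul_distrib]
  exact Finset.prod_congr rfl fun i _ => by ring

variable {n : ℕ} {M : Type*} [TopologicalSpace M] [ChartedSpace (Euc n) M] [IsManifold (𝓡 n) ∞ M]
variable {g : Metric n M} {κ c : ℝ}

theorem renormalizedVolume_einsteinAmbient (hg : IsEinstein g (κ / 2)) (c : ℝ) (x : M) {u : ℝ}
    (hu : 0 < 1 + κ * u) :
    (einsteinAmbient hg c).renormalizedVolume x u = (1 + κ * u) ^ ((n : ℝ) / 4) := by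
  have hd := gramDet_pos g (mem_extChartAt_target (I := 𝓡 n) x)
  change Real.exp (-((n : ℝ) / 4 * Real.log (1 + κ * u) + c)) / Real.exp (-c) *
    √(gramDet (einsteinMetric g κ u) x (extChartAt (𝓡 n) x x) /
      gramDet g x (extChartAt (𝓡 n) x x)) = _
  rw [einsteinMetric_of_pos g hu, gramDet_scaleMetric, mul_div_cancel_right₀ _ hd.ne',
    ← Real.exp_sub, neg_add, add_sub_cancel_right, exp_neg_mul_log_mul_sqrt_pow hu]
  congr 1
  ring

theorem volumeCoeff_einsteinAmbient (hg : IsEinstein g (κ / 2)) (c : ℝ) (k : ℕ) (x : M) :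
    (einsteinAmbient hg c).volumeCoeff k x =
      (κ / 4) ^ k / (k.factorial : ℝ) * ∏ i ∈ Finset.range k, ((n : ℝ) - 4 * i) := by
  have hvolume : (einsteinAmbient hg c).renormalizedVolume x =ᶠ[𝓝 0]
      fun u => (1 + κ * u) ^ ((n : ℝ) / 4) :=
    (eventually_one_add_mul_pos κ).mono fun u hu => renormalizedVolume_einsteinAmbient hg c x hu
  rw [NormalAmbientSpace.volumeCoeff, hvolume.iteratedDeriv_eq,
    iteratedDeriv_one_add_mul_rpow κ _ k (by simp), pow_mul_prod_div_four_sub, mul_zero, add_zero,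
    Real.one_rpow, mul_one, mul_div_right_comm]

theorem NormalAmbientSpace.volumeCoeff_of_einstein (hg : IsEinstein g (κ / 2))
    (B : NormalAmbientSpace g fun _ => c) (k : ℕ) (x : M) :
    B.volumeCoeff k x =
      (κ / 4) ^ k / (k.factorial : ℝ) * ∏ i ∈ Finset.range k, ((n : ℝ) - 4 * i) := by
  rw [B.volumeCoeff_eq (einsteinAmbient hg c), volumeCoeff_einsteinAmbient]

end EinsteinVolumeCoeff

/-! ### Uniqueness of analytic ambient spaces -/

section AnalyticUniqueness

theorem eqOn_of_iteratedDeriv_eq {W : Type*} [NormedAddCommGroup W] [NormedSpace ℝ W]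
    [CompleteSpace W] {f g : ℝ → W} {J : Set ℝ} {a : ℝ} (hf : AnalyticOnNhd ℝ f J)
    (hg : AnalyticOnNhd ℝ g J) (hJ : IsPreconnected J) (ha : a ∈ J)
    (h : ∀ k, iteratedDeriv k f a = iteratedDeriv k g a) : Set.EqOn f g J := by
  refine hf.eqOn_of_preconnected_of_eventuallyEq hg hJ ha ?_
  have hsub : AnalyticAt ℝ (f - g) a := (hf a ha).sub (hg a ha)
  have horder : analyticOrderAt (f - g) a = ⊤ := ENat.eq_top_iff_forall_ge.2 fun m =>
    (natCast_le_analyticOrderAt_iff_iteratedDeriv_eq_zero hsub).2 fun k _ => by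
      rw [iteratedDeriv_sub (hf a ha).contDiffAt (hg a ha).contDiffAt, h, sub_self]
  exact (analyticOrderAt_eq_top.1 horder).mono fun u hu => sub_eq_zero.1 hu

variable {n : ℕ} {M : Type*} [TopologicalSpace M] [ChartedSpace (Euc n) M] [IsManifold (𝓡 n) ∞ M]
variable {g : Metric n M} {κ c : ℝ}

namespace NormalAmbientSpace

variable {A : NormalAmbientSpace g fun _ => c}

/-- On its whole interval, the ambient space is the one given by `(1 + κ u) g` and
`(n / 4) log (1 + κ u) + c`. -/
structure IsExplicit (A : NormalAmbientSpace g fun _ => c) (κ : ℝ) : Prop where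
  pos : ∀ u ∈ A.dom, 0 < 1 + κ * u
  metric_eq : ∀ u ∈ A.dom, A.metric u = einsteinMetric g κ u
  potential_eq : ∀ u ∈ A.dom, A.potential u = einsteinPotential M n κ c u

theorem isExplicit_einsteinAmbient (hg : IsEinstein g (κ / 2)) (c : ℝ) :
    (einsteinAmbient hg c).IsExplicit κ :=
  ⟨fun _ hu => hu, fun _ _ => rfl, fun _ _ => rfl⟩

theorem IsAnalytic.inner_eq (hA : A.IsAnalytic) (hg : IsEinstein g (κ / 2)) {u : ℝ}
    (hu : u ∈ A.dom) (x : M) (X Y : TangentSpace (𝓡 n) x) :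
    (A.metric u).inner x X Y = (1 + κ * u) * g.inner x X Y := by
  refine inner_eq_mul_of_coordMetric (fun X Y => ?_) X Y
  set y := extChartAt (𝓡 n) x x
  refine eqOn_of_iteratedDeriv_eq (f := fun u => coordMetric (A.metric u) x y X Y)
    (g := fun u => (1 + κ * u) * coordMetric g x y X Y) ((hA _).1 _ _) (fun u _ => by fun_prop)
    A.ordConnected_dom.isPreconnected A.zero_mem_dom (fun k => ?_) hu
  have hjet := (A.jetEqOn (einsteinAmbient hg c) x k).1.comp (Φ := fun b => b X Y)
    fun _ _ => by fun_prop
  refine (hjet.iteratedDeriv_eq (mem_extChartAt_target x)).trans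
    (EventuallyEq.iteratedDeriv_eq k ?_)
  filter_upwards [eventually_one_add_mul_pos κ] with u hu
  change coordMetric (einsteinMetric g κ u) x y X Y = _
  rw [coordMetric_einsteinMetric g hu]
  rfl

theorem IsAnalytic.one_add_mul_pos [Nonempty M] (hn : 0 < n) (hA : A.IsAnalytic)
    (hg : IsEinstein g (κ / 2)) {u : ℝ} (hu : u ∈ A.dom) : 0 < 1 + κ * u := by
  obtain ⟨x⟩ := ‹Nonempty M›
  let X : Euc n := EuclideanSpace.single ⟨0, hn⟩ 1
  have hX : X ≠ 0 := by simp [X]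
  have hpos := ((A.metric u).pos x X hX).trans_eq (hA.inner_eq hg hu x X X)
  exact pos_of_mul_pos_left hpos (g.pos x X hX).le

theorem IsAnalytic.potential_eq (hA : A.IsAnalytic) (hg : IsEinstein g (κ / 2))
    (hpos : ∀ u ∈ A.dom, 0 < 1 + κ * u) {u : ℝ} (hu : u ∈ A.dom) :
    A.potential u = einsteinPotential M n κ c u := by
  funext x
  refine eqOn_of_iteratedDeriv_eq (f := fun u => A.potential u x)
    (g := fun u => einsteinPotential M n κ c u x) (hA x).2
    ((analyticOnNhd_log_one_add_mul κ _ c).mono hpos) A.ordConnected_dom.isPreconnected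
    A.zero_mem_dom (fun k => ?_) hu
  simpa only [coordFun, extChartAt_to_inv] using!
    (A.jetEqOn (einsteinAmbient hg c) x k).2.iteratedDeriv_eq (mem_extChartAt_target x)

theorem IsAnalytic.isExplicit [Nonempty M] (hn : 0 < n) (hA : A.IsAnalytic)
    (hg : IsEinstein g (κ / 2)) : A.IsExplicit κ where
  pos _ hu := hA.one_add_mul_pos hn hg hu
  metric_eq u hu := by
    rw [einsteinMetric_of_pos g (hA.one_add_mul_pos hn hg hu)]
    exact metric_ext (hA.inner_eq hg hu)
  potential_eq _ hu := hA.potential_eq hg (fun _ hu => hA.one_add_mul_pos hn hg hu) hu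

end NormalAmbientSpace

end AnalyticUniqueness

/-! ### The flow along the ambient vector field -/

section EinsteinFlow

variable {n : ℕ} {M : Type*} [TopologicalSpace M] [ChartedSpace (Euc n) M] [IsManifold (𝓡 n) ∞ M]
variable {g : Metric n M} {κ c r : ℝ}

theorem isEinstein_scaleMetric (hg : IsEinstein g r) {s : ℝ} (hs : 0 < s) :
    IsEinstein (scaleMetric g s hs) (r / s) := by
  intro p y hy X Y
  have hinv : ∀ᶠ x in 𝓝 y, (coordMetric g p x).IsInvertible :=
    mem_of_superset ((isOpen_extChartAt_target p).mem_nhds hy) fun _ => isInvertible_coordMetric g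
  have hcoord : coordMetric (scaleMetric g s hs) p = fun y => s • coordMetric g p y :=
    funext fun y => coordMetric_scaleMetric g hs p y
  rw [hcoord, ricci_smul hinv hs.ne', hg p y hy]
  change _ = r / s * (s * coordMetric g p y X Y)
  rw [← mul_assoc, div_mul_cancel₀ r hs.ne']

theorem scalarCurvature_of_einstein (hg : IsEinstein g r) {p : M} {y : Euc n}
    (hy : y ∈ (extChartAt (𝓡 n) p).target) : scalarCurvature (coordMetric g p) y = n * r := by
  have hricci : ricci (coordMetric g p) y = r • (coordMetric g p y).toLinearMap₁₂ :=
    LinearMap.ext₂ (hg p y hy)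
  rw [scalarCurvature, hricci, metricTrace_smul, metricTrace_self (isInvertible_coordMetric g hy),
    finrank_euclideanSpace_fin, mul_comm]

theorem vOne_of_einstein (hg : IsEinstein g r) (c : ℝ) (x : M) :
    vOne g (fun _ => c) x = n * r / 2 := by
  have hconst : coordFun (n := n) (fun _ : M => c) x = fun _ => c := rfl
  rw [vOne, weightedScalar, hconst, laplacian_const, gradSq_const,
    scalarCurvature_of_einstein hg (mem_extChartAt_target x)]
  ring

theorem hasDerivAt_one_add_mul_neg (κ t : ℝ) : HasDerivAt (fun t => 1 + κ * -t) (-κ) t := by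
  simpa using ((hasDerivAt_id t).neg.const_mul κ).const_add 1

theorem hasDerivAt_log_one_add_mul_neg {t : ℝ} (ht : 0 < 1 + κ * -t) (a c : ℝ) :
    HasDerivAt (fun t => a * Real.log (1 + κ * -t) + c) (-(a * (κ / (1 + κ * -t)))) t :=
  ((((hasDerivAt_one_add_mul_neg κ t).log ht.ne').const_mul a).add_const c).congr_deriv (by ring)

namespace NormalAmbientSpace

variable {A : NormalAmbientSpace g fun _ => c} {w : ℝ → M → ℝ} {t : ℝ}

theorem isOpen_times (A : NormalAmbientSpace g fun _ => c) : IsOpen A.times :=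
  A.isOpen_dom.preimage continuous_neg

theorem zero_mem_times (A : NormalAmbientSpace g fun _ => c) : (0 : ℝ) ∈ A.times := by
  simpa [times] using A.zero_mem_dom

theorem isPreconnected_times (A : NormalAmbientSpace g fun _ => c) : IsPreconnected A.times :=
  (A.ordConnected_dom.preimage_anti fun _ _ h => neg_le_neg h).isPreconnected

theorem flowMetric_zero (A : NormalAmbientSpace g fun _ => c) : A.flowMetric 0 = g := by
  rw [flowMetric, neg_zero, A.metric_zero]

theorem IsIntegralFlow.flowPotential_zero (hw : A.IsIntegralFlow w) :
    A.flowPotential w 0 = fun _ => c := by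
  funext x
  rw [flowPotential, hw.1, neg_zero, A.potential_zero, sub_zero]

namespace IsExplicit

theorem vOne_eq (hA : A.IsExplicit κ) (hg : IsEinstein g (κ / 2)) {u : ℝ} (hu : u ∈ A.dom)
    (x : M) : vOne (A.metric u) (A.potential u) x = (n : ℝ) / 4 * (κ / (1 + κ * u)) := by
  have hpos := hA.pos u hu
  rw [hA.metric_eq u hu, hA.potential_eq u hu, einsteinMetric_of_pos g hpos]
  exact (vOne_of_einstein (isEinstein_scaleMetric hg hpos) _ x).trans (by ring)

theorem isIntegralFlow (hA : A.IsExplicit κ) (hg : IsEinstein g (κ / 2)) :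
    A.IsIntegralFlow fun t _ => -((n : ℝ) / 4) * Real.log (1 + κ * -t) + 0 := by
  refine ⟨fun x => by simp, fun t ht x => ?_⟩
  rw [hA.vOne_eq hg ht]
  exact (hasDerivAt_log_one_add_mul_neg (hA.pos _ ht) _ _).congr_deriv (by ring)

theorem integralFlow_eq (hA : A.IsExplicit κ) (hg : IsEinstein g (κ / 2))
    (hw : A.IsIntegralFlow w) (ht : t ∈ A.times) (x : M) :
    w t x = -((n : ℝ) / 4) * Real.log (1 + κ * -t) := by
  have hexplicit := hA.isIntegralFlow hg
  rw [← add_zero (_ * _)]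
  exact A.isOpen_times.eqOn_of_deriv_eq A.isPreconnected_times
    (fun s hs => (hw.2 s hs x).differentiableAt.differentiableWithinAt)
    (fun s hs => (hexplicit.2 s hs x).differentiableAt.differentiableWithinAt)
    (fun s hs => (hw.2 s hs x).deriv.trans (hexplicit.2 s hs x).deriv.symm) A.zero_mem_times
    ((hw.1 x).trans (hexplicit.1 x).symm) ht

theorem flowPotential_eq (hA : A.IsExplicit κ) (hg : IsEinstein g (κ / 2))
    (hw : A.IsIntegralFlow w) (ht : t ∈ A.times) :
    A.flowPotential w t = fun _ => (n : ℝ) / 2 * Real.log (1 + κ * -t) + c := by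
  funext x
  rw [flowPotential, hA.potential_eq _ ht, hA.integralFlow_eq hg hw ht, einsteinPotential]
  ring

theorem flowMetric_eq (hA : A.IsExplicit κ) (ht : t ∈ A.times) :
    A.flowMetric t = scaleMetric g (1 + κ * -t) (hA.pos _ ht) := by
  rw [flowMetric, hA.metric_eq _ ht, einsteinMetric_of_pos]

theorem isEinstein_flowMetric (hA : A.IsExplicit κ) (hg : IsEinstein g (κ / 2))
    (ht : t ∈ A.times) : IsEinstein (A.flowMetric t) (κ / (1 + κ * -t) / 2) := by
  rw [hA.flowMetric_eq ht, div_right_comm]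
  exact isEinstein_scaleMetric hg _

theorem coordMetric_flowMetric (hA : A.IsExplicit κ) (ht : t ∈ A.times) (p : M) (y : Euc n) :
    coordMetric (A.flowMetric t) p y = (1 + κ * -t) • coordMetric g p y := by
  rw [hA.flowMetric_eq ht, coordMetric_scaleMetric]

theorem isSmoothFamily_flow (hA : A.IsExplicit κ) (hg : IsEinstein g (κ / 2))
    (hw : A.IsIntegralFlow w) : IsSmoothFamily A.times A.flowMetric (A.flowPotential w) := by
  have hlog : ContDiffOn ℝ ∞ (fun t => (n : ℝ) / 2 * Real.log (1 + κ * -t) + c) A.times :=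
    ((analyticOnNhd_log_one_add_mul κ _ c).contDiffOn
      (isOpen_one_add_mul_pos κ).uniqueDiffOn).comp contDiff_neg.contDiffOn fun t ht => hA.pos _ ht
  exact isSmoothFamily_of_scaled (g := g) (a := fun t => 1 + κ * -t) (by fun_prop) hlog
    (fun t ht p y _ => hA.coordMetric_flowMetric ht p y)
    (fun t ht x => congrFun (hA.flowPotential_eq hg hw ht) x)

variable {p : M} {y : Euc n}

theorem hasDerivAt_coordMetric_flowMetric (hA : A.IsExplicit κ) (hg : IsEinstein g (κ / 2))
    (hw : A.IsIntegralFlow w) (ht : t ∈ A.times) (hy : y ∈ (extChartAt (𝓡 n) p).target)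
    (X Y : Euc n) :
    HasDerivAt (fun s => coordMetric (A.flowMetric s) p y X Y)
      (-2 * weightedRicci (coordMetric (A.flowMetric t) p) (coordFun (A.flowPotential w t) p)
        y X Y) t := by
  have hconst : coordFun (n := n) (A.flowPotential w t) p =
      fun _ => (n : ℝ) / 2 * Real.log (1 + κ * -t) + c := by
    rw [hA.flowPotential_eq hg hw ht]; rfl
  have hnear : (fun s => coordMetric (A.flowMetric s) p y X Y) =ᶠ[𝓝 t]
      fun s => (1 + κ * -s) * coordMetric g p y X Y := by
    filter_upwards [A.isOpen_times.mem_nhds ht] with s hs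
    rw [hA.coordMetric_flowMetric hs]; rfl
  rw [weightedRicci, hconst, hessian_const, add_zero, hA.isEinstein_flowMetric hg ht p y hy,
    hA.coordMetric_flowMetric ht]
  refine (((hasDerivAt_one_add_mul_neg κ t).mul_const _).congr_of_eventuallyEq hnear).congr_deriv ?_
  change -κ * coordMetric g p y X Y =
    -2 * (κ / (1 + κ * -t) / 2 * ((1 + κ * -t) * coordMetric g p y X Y))
  linear_combination coordMetric g p y X Y * div_mul_cancel₀ κ (hA.pos _ ht).ne'

theorem hasDerivAt_coordFun_flowPotential (hA : A.IsExplicit κ) (hg : IsEinstein g (κ / 2))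
    (hw : A.IsIntegralFlow w) (ht : t ∈ A.times) (hy : y ∈ (extChartAt (𝓡 n) p).target) :
    HasDerivAt (fun s => coordFun (A.flowPotential w s) p y)
      (-scalarCurvature (coordMetric (A.flowMetric t) p) y
        - laplacian (coordMetric (A.flowMetric t) p) (coordFun (A.flowPotential w t) p) y) t := by
  have hconst {s : ℝ} (hs : s ∈ A.times) : coordFun (n := n) (A.flowPotential w s) p =
      fun _ => (n : ℝ) / 2 * Real.log (1 + κ * -s) + c := by
    rw [hA.flowPotential_eq hg hw hs]; rfl
  have hnear : (fun s => coordFun (n := n) (A.flowPotential w s) p y) =ᶠ[𝓝 t]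
      fun s => (n : ℝ) / 2 * Real.log (1 + κ * -s) + c := by
    filter_upwards [A.isOpen_times.mem_nhds ht] with s hs
    rw [hconst hs]
  rw [hconst ht, laplacian_const,
    scalarCurvature_of_einstein (hA.isEinstein_flowMetric hg ht) hy]
  refine ((hasDerivAt_log_one_add_mul_neg (hA.pos _ ht) _ _).congr_of_eventuallyEq
    hnear).congr_deriv ?_
  ring

theorem isGradientRicciFlow (hA : A.IsExplicit κ) (hg : IsEinstein g (κ / 2))
    (hw : A.IsIntegralFlow w) : IsGradientRicciFlow A.times A.flowMetric (A.flowPotential w) :=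
  ⟨hA.isSmoothFamily_flow hg hw, fun _ ht _ _ hy =>
    ⟨hA.hasDerivAt_coordMetric_flowMetric hg hw ht hy,
      hA.hasDerivAt_coordFun_flowPotential hg hw ht hy⟩⟩

theorem volumeCoeff_eq (hA : A.IsExplicit κ) (hg : IsEinstein g (κ / 2))
    (hw : A.IsIntegralFlow w) (ht : t ∈ A.times)
    (B : NormalAmbientSpace (A.flowMetric t) (A.flowPotential w t)) (k : ℕ) (x : M) :
    B.volumeCoeff k x = (κ / (1 + κ * -t) / 4) ^ k / (k.factorial : ℝ) *
      ∏ i ∈ Finset.range k, ((n : ℝ) - 4 * i) := by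
  revert B
  rw [hA.flowPotential_eq hg hw ht]
  exact fun B => B.volumeCoeff_of_einstein (hA.isEinstein_flowMetric hg ht) k x

theorem nonempty_normalAmbientSpace (hA : A.IsExplicit κ) (hg : IsEinstein g (κ / 2))
    (hw : A.IsIntegralFlow w) (ht : t ∈ A.times) :
    Nonempty (NormalAmbientSpace (A.flowMetric t) (A.flowPotential w t)) := by
  rw [hA.flowPotential_eq hg hw ht]
  exact ⟨einsteinAmbient (hA.isEinstein_flowMetric hg ht) _⟩

end IsExplicit

end NormalAmbientSpace

end EinsteinFlow

/-! ### The Riemannian volume -/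

section RiemannianVolume

variable {n : ℕ} {M : Type*} [TopologicalSpace M] [ChartedSpace (Euc n) M] [IsManifold (𝓡 n) ∞ M]

theorem continuousOn_gramDet (g : Metric n M) (p : M) :
    ContinuousOn (gramDet g p) (extChartAt (𝓡 n) p).target :=
  (contDiff_bilDet.continuous.comp_continuousOn (contDiffOn_coordMetric g p).continuousOn).congr
    fun y _ => gramDet_eq_bilDet g p y

variable [T2Space M] [SigmaCompactSpace M]

/-- The density `ρ_p √(det g_ij)` of the part of the Riemannian volume carried by the chart at
`p`. -/
noncomputable def volumeDensity (g : Metric n M) (p : M) (y : Euc n) : ℝ :=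
  chartPartition n M p ((extChartAt (𝓡 n) p).symm y) * √(gramDet g p y)

theorem continuousOn_volumeDensity (g : Metric n M) (p : M) :
    ContinuousOn (volumeDensity g p) (extChartAt (𝓡 n) p).target :=
  ((chartPartition n M p).contMDiff.continuous.comp_continuousOn
    (continuousOn_extChartAt_symm p)).mul (continuousOn_gramDet g p).sqrt

theorem volumeDensity_scaleMetric (g : Metric n M) {s : ℝ} (hs : 0 < s) (p : M) (y : Euc n) :
    volumeDensity (scaleMetric g s hs) p y = √(s ^ n) * volumeDensity g p y := by
  rw [volumeDensity, gramDet_scaleMetric, Real.sqrt_mul (by positivity), mul_left_comm,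
    volumeDensity]

/-- The part of the Riemannian volume carried by the chart at `p`. -/
noncomputable def chartVolume [MeasurableSpace M] (g : Metric n M) (p : M) : Measure M :=
  (((volume : Measure (Euc n)).restrict (extChartAt (𝓡 n) p).target).withDensity fun y =>
    ENNReal.ofReal (volumeDensity g p y)).map (extChartAt (𝓡 n) p).symm

theorem riemannianVolume_eq_sum [MeasurableSpace M] (g : Metric n M) :
    riemannianVolume g = Measure.sum (chartVolume g) := rfl

theorem chartVolume_scaleMetric [MeasurableSpace M] (g : Metric n M) {s : ℝ} (hs : 0 < s)
    (p : M) : chartVolume (scaleMetric g s hs) p = ENNReal.ofReal √(s ^ n) • chartVolume g p := by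
  have hdensity : (fun y => ENNReal.ofReal (volumeDensity (scaleMetric g s hs) p y)) =
      ENNReal.ofReal √(s ^ n) • fun y => ENNReal.ofReal (volumeDensity g p y) := by
    funext y
    rw [volumeDensity_scaleMetric, ENNReal.ofReal_mul (Real.sqrt_nonneg _), Pi.smul_apply,
      smul_eq_mul]
  rw [chartVolume, hdensity, withDensity_smul' _ _ ENNReal.ofReal_ne_top, Measure.map_smul,
    chartVolume]

theorem riemannianVolume_scaleMetric [MeasurableSpace M] (g : Metric n M) {s : ℝ} (hs : 0 < s) :
    riemannianVolume (scaleMetric g s hs) = ENNReal.ofReal √(s ^ n) • riemannianVolume g := by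
  ext t ht
  simp only [riemannianVolume_eq_sum, Measure.smul_apply, Measure.sum_apply _ ht, smul_eq_mul,
    chartVolume_scaleMetric, ENNReal.tsum_mul_left]

theorem tsupport_chartPartition_subset (p : M) :
    tsupport (chartPartition n M p) ⊆ (extChartAt (𝓡 n) p).source := by
  rw [extChartAt_source]
  exact chartPartition_subordinate n M p

theorem integrableOn_volumeDensity [CompactSpace M] (g : Metric n M) (p : M) :
    IntegrableOn (volumeDensity g p) (extChartAt (𝓡 n) p).target := by
  have hsupp := tsupport_chartPartition_subset (n := n) p
  have hcompact : IsCompact (extChartAt (𝓡 n) p '' tsupport (chartPartition n M p)) :=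
    (isClosed_tsupport _).isCompact.image_of_continuousOn ((continuousOn_extChartAt p).mono hsupp)
  have hsubset : extChartAt (𝓡 n) p '' tsupport (chartPartition n M p) ⊆
      (extChartAt (𝓡 n) p).target :=
    Set.image_subset_iff.2 fun _ hx => (extChartAt (𝓡 n) p).map_source (hsupp hx)
  refine (((continuousOn_volumeDensity g p).mono hsubset).integrableOn_compact
    hcompact).of_forall_sdiff_eq_zero (isOpen_extChartAt_target p).measurableSet fun y hy => ?_
  exact mul_eq_zero_of_left (image_eq_zero_of_notMem_tsupport fun h =>
    hy.2 ⟨_, h, (extChartAt (𝓡 n) p).right_inv hy.1⟩) _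

variable [MeasurableSpace M] [BorelSpace M]

theorem chartVolume_univ (g : Metric n M) (p : M) : chartVolume g p Set.univ =
    ∫⁻ y in (extChartAt (𝓡 n) p).target, ENNReal.ofReal (volumeDensity g p y) := by
  have hmeas : AEMeasurable (extChartAt (𝓡 n) p).symm
      ((volume : Measure (Euc n)).restrict (extChartAt (𝓡 n) p).target) :=
    (continuousOn_extChartAt_symm p).aemeasurable (isOpen_extChartAt_target p).measurableSet
  rw [chartVolume, Measure.map_apply_of_aemeasurable
    (hmeas.mono_ac (withDensity_absolutelyContinuous _ _)) MeasurableSet.univ, Set.preimage_univ,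
    withDensity_apply _ MeasurableSet.univ, Measure.restrict_univ]

theorem chartVolume_univ_lt_top [CompactSpace M] (g : Metric n M) (p : M) :
    chartVolume g p Set.univ < ⊤ := by
  rw [chartVolume_univ]
  exact (integrableOn_volumeDensity g p).lintegral_lt_top

theorem chartVolume_univ_ne_zero (g : Metric n M) {p x : M} (hx : 0 < chartPartition n M p x) :
    chartVolume g p Set.univ ≠ 0 := by
  have hsource := tsupport_chartPartition_subset (n := n) p (subset_tsupport _ hx.ne')
  have htarget := (extChartAt (𝓡 n) p).map_source hsource
  have hpos : 0 < volumeDensity g p (extChartAt (𝓡 n) p x) :=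
    mul_pos (by rwa [(extChartAt (𝓡 n) p).left_inv hsource])
      (Real.sqrt_pos.2 (gramDet_pos g htarget))
  have hopen : IsOpen (extChartAt (𝓡 n) p).target := isOpen_extChartAt_target p
  have hcont := ENNReal.continuous_ofReal.comp_continuousOn (continuousOn_volumeDensity g p)
  rw [chartVolume_univ]
  intro hzero
  have hae := (lintegral_eq_zero_iff' (hcont.aemeasurable hopen.measurableSet)).1 hzero
  exact (ENNReal.ofReal_pos.2 hpos).ne'
    (Measure.eqOn_open_of_ae_eq hae hopen hcont continuousOn_const htarget)

theorem isFiniteMeasure_riemannianVolume [CompactSpace M] (g : Metric n M) :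
    IsFiniteMeasure (riemannianVolume g) := by
  have hfinite := (chartPartition n M).locallyFinite.finite_nonempty_of_compact
  have hvanish (p : M) (hp : p ∉ hfinite.toFinset) : chartVolume g p Set.univ = 0 := by
    have hpartition : ⇑(chartPartition n M p) = 0 := by simpa using hp
    simp [chartVolume_univ, volumeDensity, hpartition]
  refine ⟨?_⟩
  rw [riemannianVolume_eq_sum, Measure.sum_apply _ MeasurableSet.univ, tsum_eq_sum hvanish]
  exact ENNReal.sum_lt_top.2 fun p _ => chartVolume_univ_lt_top g p

theorem riemannianVolume_univ_ne_zero [Nonempty M] (g : Metric n M) :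
    riemannianVolume g Set.univ ≠ 0 := by
  obtain ⟨x⟩ := ‹Nonempty M›
  obtain ⟨p, hp⟩ := (chartPartition n M).exists_pos_of_mem (Set.mem_univ x)
  rw [riemannianVolume_eq_sum, Ne, Measure.sum_apply_eq_zero' MeasurableSet.univ]
  exact fun h => chartVolume_univ_ne_zero g hp (h p)

theorem riemannianVolume_real_pos [CompactSpace M] [Nonempty M] (g : Metric n M) :
    0 < (riemannianVolume g).real Set.univ := by
  have := isFiniteMeasure_riemannianVolume g
  exact ENNReal.toReal_pos (riemannianVolume_univ_ne_zero g) (measure_ne_top _ _)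

end RiemannianVolume

/-! ### Monotonicity of the functionals -/

section Monotonicity

theorem prod_sub_four_mul_pos {n j k : ℕ} (hj : 4 * (j - 1) < n) (hk : k ≤ j) :
    0 < ∏ i ∈ Finset.range k, ((n : ℝ) - 4 * i) :=
  Finset.prod_pos fun i hi => sub_pos.2 (by have := Finset.mem_range.1 hi; norm_cast; omega)

theorem prod_sub_four_mul_eq_zero {n j k : ℕ} (hn : n = 4 * j) (hk : j < k) :
    ∏ i ∈ Finset.range k, ((n : ℝ) - 4 * i) = 0 :=
  Finset.prod_eq_zero (Finset.mem_range.2 hk) (by rw [hn]; push_cast; ring)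

theorem sub_four_mul_neg {n k : ℕ} (h : n < 4 * k) : (n : ℝ) - 4 * k < 0 :=
  sub_neg.2 (by exact_mod_cast h)

theorem prod_sub_four_mul_add_two_mul_pos {n j : ℕ} (hj : 4 * (j - 1) < n) (hn : n < 4 * j)
    (s : ℕ) : 0 < ∏ i ∈ Finset.range (j + 2 * s), ((n : ℝ) - 4 * i) := by
  induction s with
  | zero => exact prod_sub_four_mul_pos hj le_rfl
  | succ s ih =>
    rw [mul_add_one, ← add_assoc, Finset.prod_range_succ, Finset.prod_range_succ]
    exact mul_pos_of_neg_of_neg (mul_neg_of_pos_of_neg ih (sub_four_mul_neg (by omega)))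
      (sub_four_mul_neg (by omega))

theorem prod_sub_four_mul_add_two_mul_sub_one_neg {n j s : ℕ} (hj : 4 * (j - 1) < n)
    (hn : n < 4 * j) (hs : 1 ≤ s) :
    ∏ i ∈ Finset.range (j + 2 * s - 1), ((n : ℝ) - 4 * i) < 0 := by
  obtain ⟨s, rfl⟩ := Nat.exists_eq_add_of_le' hs
  rw [show j + 2 * (s + 1) - 1 = j + 2 * s + 1 by omega, Finset.prod_range_succ]
  exact mul_neg_of_pos_of_neg (prod_sub_four_mul_add_two_mul_pos hj hn s)
    (sub_four_mul_neg (by omega))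

variable {n : ℕ} {M : Type*} [TopologicalSpace M] [ChartedSpace (Euc n) M] [IsManifold (𝓡 n) ∞ M]
  [T2Space M] [MeasurableSpace M]
variable {g : Metric n M} {κ c : ℝ}

/-- The weighted volume `∫_M e^{-φ} dvol_g`, which the gradient Ricci flow preserves. -/
noncomputable def weightedVolume [SigmaCompactSpace M] (g : Metric n M) (φ : M → ℝ) : ℝ :=
  ∫ x, Real.exp (-φ x) ∂(riemannianVolume g)

theorem weightedVolume_const [SigmaCompactSpace M] (g : Metric n M) (c : ℝ) :
    weightedVolume g (fun _ => c) = (riemannianVolume g).real Set.univ * Real.exp (-c) := by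
  rw [weightedVolume, integral_const, smul_eq_mul]

theorem weightedVolume_const_pos [CompactSpace M] [Nonempty M] [BorelSpace M] (g : Metric n M)
    (c : ℝ) : 0 < weightedVolume g fun _ => c := by
  rw [weightedVolume_const]
  exact mul_pos (riemannianVolume_real_pos g) (Real.exp_pos _)

namespace NormalAmbientSpace.IsExplicit

variable {A : NormalAmbientSpace g fun _ => c} {w : ℝ → M → ℝ}

theorem weightedVolume_flow [SigmaCompactSpace M] (hA : A.IsExplicit κ)
    (hg : IsEinstein g (κ / 2)) (hw : A.IsIntegralFlow w) {t : ℝ} (ht : t ∈ A.times) :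
    weightedVolume (A.flowMetric t) (A.flowPotential w t) = weightedVolume g fun _ => c := by
  have hcancel := exp_neg_mul_log_mul_sqrt_pow (hA.pos _ ht) ((n : ℝ) / 2) n
  rw [sub_self, Real.rpow_zero] at hcancel
  rw [hA.flowPotential_eq hg hw ht, weightedVolume_const, weightedVolume_const,
    hA.flowMetric_eq ht, riemannianVolume_scaleMetric, measureReal_ennreal_smul_apply,
    ENNReal.toReal_ofReal (Real.sqrt_nonneg _), neg_add, Real.exp_add]
  linear_combination (riemannianVolume g).real Set.univ * Real.exp (-c) * hcancel

theorem functional_eq [SigmaCompactSpace M] (hA : A.IsExplicit κ) (hg : IsEinstein g (κ / 2))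
    (hw : A.IsIntegralFlow w) {t : ℝ} (ht : t ∈ A.times)
    (B : NormalAmbientSpace (A.flowMetric t) (A.flowPotential w t)) (k : ℕ) :
    B.functional k = (κ / (1 + κ * -t)) ^ k *
      ((∏ i ∈ Finset.range k, ((n : ℝ) - 4 * i)) *
        ((weightedVolume g fun _ => c) / (4 ^ k * (k.factorial : ℝ)))) := by
  simp only [functional, hA.volumeCoeff_eq hg hw ht]
  rw [integral_const_mul, ← weightedVolume, hA.weightedVolume_flow hg hw ht, div_pow]
  ring

omit [T2Space M] [MeasurableSpace M] in
theorem strictMono_div_pow (hA : A.IsExplicit κ) (hκ : 0 < κ) {k : ℕ} (hk : 1 ≤ k) :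
    StrictMono fun t : A.times => (κ / (1 + κ * -(t : ℝ))) ^ k := by
  intro s t hst
  have hs := hA.pos _ s.2
  have ht := hA.pos _ t.2
  have hst' : (s : ℝ) < t := hst
  refine pow_lt_pow_left₀ ?_ (by positivity) (by omega)
  gcongr

variable [CompactSpace M] {k : ℕ}
  (B : (t : A.times) → NormalAmbientSpace (A.flowMetric t) (A.flowPotential w t))

theorem strictMono_functional [Nonempty M] [BorelSpace M] (hA : A.IsExplicit κ) (hκ : 0 < κ)
    (hg : IsEinstein g (κ / 2)) (hw : A.IsIntegralFlow w) (hk : 1 ≤ k)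
    (hprod : 0 < ∏ i ∈ Finset.range k, ((n : ℝ) - 4 * i)) :
    StrictMono fun t => (B t).functional k := by
  have hmass := weightedVolume_const_pos g c
  simp only [fun t : A.times => hA.functional_eq hg hw t.2 (B t) k]
  exact (hA.strictMono_div_pow hκ hk).mul_const (by positivity)

theorem strictAnti_functional [Nonempty M] [BorelSpace M] (hA : A.IsExplicit κ) (hκ : 0 < κ)
    (hg : IsEinstein g (κ / 2)) (hw : A.IsIntegralFlow w) (hk : 1 ≤ k)
    (hprod : ∏ i ∈ Finset.range k, ((n : ℝ) - 4 * i) < 0) :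
    StrictAnti fun t => (B t).functional k := by
  have hmass := weightedVolume_const_pos g c
  simp only [fun t : A.times => hA.functional_eq hg hw t.2 (B t) k]
  exact fun s t hst => mul_lt_mul_of_neg_right (hA.strictMono_div_pow hκ hk hst)
    (mul_neg_of_neg_of_pos hprod (by positivity))

omit [CompactSpace M] in
theorem functional_eq_zero [SigmaCompactSpace M] (hA : A.IsExplicit κ)
    (hg : IsEinstein g (κ / 2)) (hw : A.IsIntegralFlow w)
    (hprod : ∏ i ∈ Finset.range k, ((n : ℝ) - 4 * i) = 0) (t : A.times) :
    (B t).functional k = 0 := by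
  rw [hA.functional_eq hg hw t.2, hprod, zero_mul, mul_zero]

end NormalAmbientSpace.IsExplicit

end Monotonicity

end WeightedAmbient

theorem theorem1p8_general {n : ℕ} (hn : 0 < n) {M : Type*} [TopologicalSpace M] [T2Space M]
    [CompactSpace M] [Nonempty M] [ChartedSpace (Euc n) M] [IsManifold (𝓡 n) ∞ M]
    [MeasurableSpace M] [BorelSpace M]
    (g : Metric n M) (μ c : ℝ) (hμ : 0 < μ) (hg : IsEinstein g (2 * μ)) :
    (∃ A : NormalAmbientSpace g (fun _ => c), A.IsAnalytic ∧ A.IsGlobal ∧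
      A.dom = Set.Ioi (-(1 / (4 * μ))) ∧ ∃ w, A.IsIntegralFlow w) ∧
    ∀ A : NormalAmbientSpace g (fun _ => c), A.IsAnalytic →
      (∀ u ∈ A.dom, 0 < 1 + 4 * μ * u ∧
        (∀ (x : M) (X Y : TangentSpace (𝓡 n) x),
          (A.metric u).inner x X Y = (1 + 4 * μ * u) * g.inner x X Y) ∧
        ∀ x : M, A.potential u x = (n : ℝ) / 4 * Real.log |1 + 4 * μ * u| + c) ∧
      ∀ w : ℝ → M → ℝ, A.IsIntegralFlow w →
        (IsGradientRicciFlow A.times A.flowMetric (A.flowPotential w) ∧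
          A.flowMetric 0 = g ∧ A.flowPotential w 0 = fun _ => c) ∧
        (∀ t : A.times, Nonempty (NormalAmbientSpace (A.flowMetric t) (A.flowPotential w t))) ∧
        ∀ B : (t : A.times) → NormalAmbientSpace (A.flowMetric t) (A.flowPotential w t),
          (∀ (t : A.times) (k : ℕ) (x : M), (B t).volumeCoeff k x =
            (μ / (1 - 4 * μ * t)) ^ k / (Nat.factorial k : ℝ) *
              ∏ i ∈ Finset.range k, ((n : ℝ) - 4 * i)) ∧
          (∀ k : ℕ, 1 ≤ k →
            (0 < ∏ i ∈ Finset.range k, ((n : ℝ) - 4 * i) →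
              StrictMono fun t => (B t).functional k) ∧
            (∏ i ∈ Finset.range k, ((n : ℝ) - 4 * i) < 0 →
              StrictAnti fun t => (B t).functional k) ∧
            (∏ i ∈ Finset.range k, ((n : ℝ) - 4 * i) = 0 →
              ∀ t, (B t).functional k = 0)) ∧
          ∀ j : ℕ, 1 ≤ j →
            (4 * (j - 1) < n ∧ n < 4 * j →
              (∀ k : ℕ, (1 ≤ k ∧ k ≤ j) ∨ (∃ s : ℕ, 1 ≤ s ∧ k = j + 2 * s) →
                StrictMono fun t => (B t).functional k) ∧
              (∀ k : ℕ, (∃ s : ℕ, 1 ≤ s ∧ k = j + 2 * s - 1) →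
                StrictAnti fun t => (B t).functional k)) ∧
            (n = 4 * j →
              (∀ k : ℕ, 1 ≤ k ∧ k ≤ j → StrictMono fun t => (B t).functional k) ∧
              (∀ k : ℕ, j < k → ∀ t, (B t).functional k = 0)) := by
  have hg' : IsEinstein g (4 * μ / 2) := by rwa [show 4 * μ / 2 = 2 * μ by ring]
  have hκ : 0 < 4 * μ := by positivity
  refine ⟨⟨einsteinAmbient hg' c, isAnalytic_einsteinAmbient hg' c, isGlobal_einsteinAmbient hg' c,
    dom_einsteinAmbient hg' c hκ, _,
    (NormalAmbientSpace.isExplicit_einsteinAmbient hg' c).isIntegralFlow hg'⟩, fun A hA => ?_⟩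
  have hE : A.IsExplicit (4 * μ) := hA.isExplicit hn hg'
  refine ⟨fun u hu => ⟨hE.pos u hu, hA.inner_eq hg' hu, fun x => ?_⟩, fun w hw =>
    ⟨⟨hE.isGradientRicciFlow hg' hw, A.flowMetric_zero, hw.flowPotential_zero⟩,
      fun t => hE.nonempty_normalAmbientSpace hg' hw t.2, fun B => ?_⟩⟩
  · rw [hE.potential_eq u hu, abs_of_pos (hE.pos u hu), einsteinPotential]
  have hmono {k : ℕ} (hk : 1 ≤ k) := hE.strictMono_functional B hκ hg' hw hk
  have hanti {k : ℕ} (hk : 1 ≤ k) := hE.strictAnti_functional B hκ hg' hw hk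
  have hzero {k : ℕ} := hE.functional_eq_zero B hg' hw (k := k)
  refine ⟨fun t k x => ?_, fun k hk => ⟨hmono hk, hanti hk, hzero⟩, fun j hj =>
    ⟨fun ⟨hjn, hnj⟩ => ⟨?_, ?_⟩, fun hnj => ⟨fun k hk => ?_, fun k hk => ?_⟩⟩⟩
  · rw [hE.volumeCoeff_eq hg' hw t.2, div_right_comm, mul_div_cancel_left₀ μ four_ne_zero, mul_neg,
      ← sub_eq_add_neg]
  · rintro k (hk | ⟨s, hs, rfl⟩)
    · exact hmono hk.1 (prod_sub_four_mul_pos hjn hk.2)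
    · exact hmono (by omega) (prod_sub_four_mul_add_two_mul_pos hjn hnj s)
  · rintro k ⟨s, hs, rfl⟩
    exact hanti (by omega) (prod_sub_four_mul_add_two_mul_sub_one_neg hjn hnj hs)
  · exact hmono hk.1 (prod_sub_four_mul_pos (by omega) hk.2)
  · exact hzero (prod_sub_four_mul_eq_zero hnj hk)

theorem theorem1p8 {n : ℕ} (hn : 3 ≤ n) {M : Type*} [TopologicalSpace M] [T2Space M]
    [CompactSpace M] [ConnectedSpace M] [ChartedSpace (Euc n) M] [IsManifold (𝓡 n) ∞ M]
    [MeasurableSpace M] [BorelSpace M]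
    (g : Metric n M) (μ c : ℝ) (hμ : 0 < μ) (hg : IsEinstein g (2 * μ)) :
    -- the global normal ambient space and the flow of the vector field exist
    (∃ A : NormalAmbientSpace g (fun _ => c), A.IsAnalytic ∧ A.IsGlobal ∧
      A.dom = Set.Ioi (-(1 / (4 * μ))) ∧ ∃ w, A.IsIntegralFlow w) ∧
    ∀ A : NormalAmbientSpace g (fun _ => c), A.IsAnalytic →
      -- the ambient metric is the explicit one
      (∀ u ∈ A.dom, 0 < 1 + 4 * μ * u ∧
        (∀ (x : M) (X Y : TangentSpace (𝓡 n) x),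
          (A.metric u).inner x X Y = (1 + 4 * μ * u) * g.inner x X Y) ∧
        ∀ x : M, A.potential u x = (n : ℝ) / 4 * Real.log |1 + 4 * μ * u| + c) ∧
      ∀ w : ℝ → M → ℝ, A.IsIntegralFlow w →
        -- along the vector field one has the gradient Ricci flow that starts at `(g, c)`
        (IsGradientRicciFlow A.times A.flowMetric (A.flowPotential w) ∧
          A.flowMetric 0 = g ∧ A.flowPotential w 0 = fun _ => c) ∧
        -- the structure at each time has a normal ambient space
        (∀ t : A.times, Nonempty (NormalAmbientSpace (A.flowMetric t) (A.flowPotential w t))) ∧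
        -- the functionals, computed from any normal ambient spaces
        ∀ B : (t : A.times) → NormalAmbientSpace (A.flowMetric t) (A.flowPotential w t),
          (∀ (t : A.times) (k : ℕ) (x : M), (B t).volumeCoeff k x =
            (μ / (1 - 4 * μ * t)) ^ k / (Nat.factorial k : ℝ) *
              ∏ i ∈ Finset.range k, ((n : ℝ) - 4 * i)) ∧
          (∀ k : ℕ, 1 ≤ k →
            (0 < ∏ i ∈ Finset.range k, ((n : ℝ) - 4 * i) →
              StrictMono fun t => (B t).functional k) ∧
            (∏ i ∈ Finset.range k, ((n : ℝ) - 4 * i) < 0 →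
              StrictAnti fun t => (B t).functional k) ∧
            (∏ i ∈ Finset.range k, ((n : ℝ) - 4 * i) = 0 →
              ∀ t, (B t).functional k = 0)) ∧
          ∀ j : ℕ, 1 ≤ j →
            (4 * (j - 1) < n ∧ n < 4 * j →
              (∀ k : ℕ, (1 ≤ k ∧ k ≤ j) ∨ (∃ s : ℕ, 1 ≤ s ∧ k = j + 2 * s) →
                StrictMono fun t => (B t).functional k) ∧
              (∀ k : ℕ, (∃ s : ℕ, 1 ≤ s ∧ k = j + 2 * s - 1) →
                StrictAnti fun t => (B t).functional k)) ∧
            (n = 4 * j →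
              (∀ k : ℕ, 1 ≤ k ∧ k ≤ j → StrictMono fun t => (B t).functional k) ∧
              (∀ k : ℕ, j < k → ∀ t, (B t).functional k = 0)) :=
  theorem1p8_general (by omega) g μ c hμ hg
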